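/- Let $T=[0,1]^2$, let $r_0$ be the $1$-periodic function equal to $1$ on $[0,\frac12)$ and to $-1$ on $[\frac12,1)$, let $r_k(x)=r_0(2^kx)$ be the Rademacher functions, and let $W_n=r_{m_1}\cdots r_{m_j}$ for $n=2^{m_1}+\dots+2^{m_j}$, $m_1>\dots>m_j\ge 0$ (with $W_0=1$), be the Walsh functions in Paley's order. For a measurable $\mu:T\to(0,1]$ let $L^1_\mu(T)$ be the space of real measurable functions $f$ on $T$ with $\iint_T|f|\,\mu\,dx\,dy<\infty$. There exists a double series $$\sum_{n,k=1}^\infty c_{n,k}W_n(x)W_k(y)\quad\text{with real coefficients and}\quad \sum_{n,k=1}^\infty|c_{n,k}|^q<\infty\ \text{ for all } q>2$$ with the following property. For every $\varepsilon>0$ there is a measurable function $\mu$ on $T$ with $$0<\mu(x,y)\le 1\ \text{ on } T,\qquad |\{(x,y)\in T:\mu(x,y)\ne 1\}|<\varepsilon,$$ such that the series is universal in $L^1_\mu(T)$ concerning subseries, with respect to convergence of both rectangular and spherical partial sums. That is, for every $f\in L^1_\mu(T)$ there is an infinite set $A$ of pairs of positive integers such that, with $S_{N,M}(x,y)=\sum_{(n,k)\in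 A,\ n\le N,\ k\le M}c_{n,k}W_n(x)W_k(y)$ and $S_R(x,y)=\sum_{(n,k)\in A,\ n^2+k^2\le R^2}c_{n,k}W_n(x)W_k(y)$, both $$\lim_{N,M\to\infty}\iint_T|S_{N,M}-f|\,\mu\,dx\,dy=0\quad\text{and}\quad \lim_{R\to\infty}\iint_T|S_R-f|\,\mu\,dx\,dy=0 ,$$ where $N,M\to\infty$ independently of each other (that is, $\min\{N,M\}\to\infty$). -/

import Mathlib

open MeasureTheory Filter Topology

noncomputable section

namespace DoubleWalsh

/-- The square `T = [0,1]²`. -/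
def T : Set (ℝ × ℝ) := Set.Icc (0 : ℝ) 1 ×ˢ Set.Icc (0 : ℝ) 1

/-- The 1-periodic function equal to `1` on `[0, 1/2)` and to `-1` on `[1/2, 1)`. -/
def rademacherZero (x : ℝ) : ℝ := if Int.fract x < 1 / 2 then 1 else -1

/-- The Rademacher functions `r_k(x) = r_0(2^k x)`. -/
def rademacher (k : ℕ) (x : ℝ) : ℝ := rademacherZero (2 ^ k * x)

/-- The Walsh functions in Paley's order: if `n = 2^{m_1} + ⋯ + 2^{m_k}` is the binary expansion
of `n` (with distinct exponents), then `W_n = r_{m_1} ⋯ r_{m_k}`; in particular `W_0 = 1`. -/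
def walsh (n : ℕ) (x : ℝ) : ℝ := ∏ m ∈ n.bitIndices.toFinset, rademacher m x

/-- The rectangular partial sum of `∑_{k,ν ≥ 1} c_{k,ν} W_k(x) W_ν(y)` over `k ≤ n`, `ν ≤ m`. -/
def rectSum (c : ℕ × ℕ → ℝ) (n m : ℕ) (p : ℝ × ℝ) : ℝ :=
  ∑ k ∈ Finset.Icc 1 n, ∑ ν ∈ Finset.Icc 1 m, c (k, ν) * walsh k p.1 * walsh ν p.2

/-- The spherical partial sum of `∑_{k,ν ≥ 1} c_{k,ν} W_k(x) W_ν(y)` over `k² + ν² ≤ R²`, for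
`R ≥ 0` (such `k`, `ν` are at most `⌊R⌋`). -/
def spherSum (c : ℕ × ℕ → ℝ) (R : ℝ) (p : ℝ × ℝ) : ℝ :=
  ∑ i ∈ (Finset.Icc 1 ⌊R⌋₊ ×ˢ Finset.Icc 1 ⌊R⌋₊) with (i.1 : ℝ) ^ 2 + (i.2 : ℝ) ^ 2 ≤ R ^ 2,
    c i * walsh i.1 p.1 * walsh i.2 p.2

/-- The weighted norm `∬_T |g| μ`, as an element of `[0, ∞]`. -/
def weightedNorm (μ g : ℝ × ℝ → ℝ) : ENNReal :=
  ∫⁻ p in T, ENNReal.ofReal (|g p| * μ p)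

/-- `f` is a (Lebesgue) measurable function on `T` with `∬_T |f| μ < ∞`. -/
def MemL1 (μ f : ℝ × ℝ → ℝ) : Prop :=
  AEMeasurable f (volume.restrict T) ∧ weightedNorm μ f < ⊤

/-- The double Walsh series with coefficients `c` is universal in `L¹_μ(T)` concerning subseries,
with respect to both rectangular and spherical convergence: every `f ∈ L¹_μ(T)` is the `L¹_μ`-limit
of the rectangular (`n, m → ∞` independently) and of the spherical (`R → ∞`) partial sums of the
subseries formed by the terms with index in a suitable infinite set `A` of pairs of positive
integers. -/
def UniversalSubseries (c : ℕ × ℕ → ℝ) (μ : ℝ × ℝ → ℝ) : Prop :=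
  ∀ f : ℝ × ℝ → ℝ, MemL1 μ f →
    ∃ A : Set (ℕ × ℕ), A.Infinite ∧ (∀ i ∈ A, 1 ≤ i.1 ∧ 1 ≤ i.2) ∧
      Tendsto (fun N : ℕ × ℕ =>
        weightedNorm μ (fun p => rectSum (A.indicator c) N.1 N.2 p - f p)) atTop (𝓝 0) ∧
      Tendsto (fun R : ℝ =>
        weightedNorm μ (fun p => spherSum (A.indicator c) R p - f p)) atTop (𝓝 0)

end DoubleWalsh

end

/-!
The series is a succession of Walsh polynomials, each of which corrects a step function on a small
set; their spectra lie in successive square blocks `[N_s, N_{s+1})²` along the diagonal.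

The building block (`exists_brick`) is, for a dyadic cell `Δ` of level `p` and `s ≥ p`,
`γ 1_Δ(x, y) (1 - ∏_{s ≤ k < s + m} (1 + r_k(x) r_k(y)))`. The product vanishes unless the binary
digits of `x` and `y` in `[s, s + m)` agree, so the brick equals `γ 1_Δ` off a set of measure
`4^{-p} 2^{-m}`. Expanding all products, `1_Δ` included, shows that its spectrum lies in
`[2^s, 2^{s+m})²` and consists of fewer than `4^p 2^m` terms with coefficients `± γ 4^{-p}`. Hence
the bricks of all `4^p` cells together contribute at most a multiple of `2^m 4^{p(2-q)}` to the sum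
of the `q`-th powers, and by orthonormality every part of one brick has `L²` norm at most
`|γ| 2^{m/2} 2^{-p}`: both are small for large `p`, when `q > 2`.

A rectangular or spherical truncation contains, with an index `i`, all pairs of positive integers
below `i`. Against spectra placed along the diagonal, such a truncation keeps some blocks entirely,
cuts at most one, and drops the rest (`IsLowerIndexSet.cut`). So off a small set a truncation of the
correction of a step function `g` is bounded by `|g|` plus a function that is small in `L¹`
(`exists_correction`).

The step functions run through a countable family that is dense in every weighted space, each
member occurring infinitely often (`exists_blockSystem`). Since the measures of the exceptional sets
are summable, there is a weight, equal to `1` off a set of measure less than `ε`, which makes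
everything that happens on the exceptional sets negligible from some number on
(`BlockSystem.exists_weight`). For a given `f` the blocks are chosen greedily
(`BlockSystem.exists_greedy`): the next step function approximates the difference of `f` and the sum
of the blocks chosen so far. That difference tends to zero, and so does the norm of the next step
function, which controls the block that a truncation cuts
(`BlockSystem.weightedNorm_partialSum_sub_le`).
-/

namespace DoubleWalsh

/-! ### Rademacher and Walsh functions -/

lemma rademacherZero_add_int (x : ℝ) (n : ℤ) :
    rademacherZero (x + n) = rademacherZero x := by
  simp [rademacherZero]

lemma rademacherZero_add_half (x : ℝ) :
    rademacherZero (x + 1 / 2) = -rademacherZero x := by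
  have h0 := Int.fract_nonneg x
  have h1 := Int.fract_lt_one x
  have hx := Int.floor_add_fract x
  unfold rademacherZero
  by_cases h : Int.fract x < 1 / 2
  · have : Int.fract (x + 1 / 2) = Int.fract x + 1 / 2 := by
      rw [Int.fract_eq_iff]
      exact ⟨by linarith, by linarith, ⌊x⌋, by linarith⟩
    rw [if_pos h, this, if_neg (by linarith)]
  · have : Int.fract (x + 1 / 2) = Int.fract x - 1 / 2 := by
      rw [Int.fract_eq_iff]
      exact ⟨by linarith, by linarith, ⌊x⌋ + 1, by push_cast; linarith⟩
    rw [if_neg h, this, if_pos (by linarith), neg_neg]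

lemma rademacher_eq_one_or (k : ℕ) (x : ℝ) : rademacher k x = 1 ∨ rademacher k x = -1 := by
  unfold rademacher rademacherZero
  split_ifs <;> simp

lemma rademacher_mul_self (k : ℕ) (x : ℝ) : rademacher k x * rademacher k x = 1 := by
  rcases rademacher_eq_one_or k x with h | h <;> simp [h]

@[fun_prop]
lemma measurable_rademacher (k : ℕ) : Measurable (rademacher k) := by
  have h : Measurable rademacherZero :=
    Measurable.ite (measurableSet_lt measurable_fract measurable_const) measurable_const
      measurable_const
  exact h.comp (measurable_const.mul measurable_id)

/-- The product of the Rademacher functions with index in `S`: the Walsh function whose number has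
the binary digits `S`. -/
noncomputable def walshSet (S : Finset ℕ) (x : ℝ) : ℝ := ∏ k ∈ S, rademacher k x

lemma walsh_eq_walshSet (n : ℕ) (x : ℝ) : walsh n x = walshSet (Finset.equivBitIndices n) x := rfl

lemma walshSet_mul_self (S : Finset ℕ) (x : ℝ) : walshSet S x * walshSet S x = 1 := by
  simp [walshSet, ← Finset.prod_mul_distrib, rademacher_mul_self]

lemma abs_walshSet (S : Finset ℕ) (x : ℝ) : |walshSet S x| = 1 := by
  rw [← sq_eq_sq₀ (abs_nonneg _) zero_le_one, sq_abs, sq, walshSet_mul_self, one_pow]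

lemma abs_walsh (n : ℕ) (x : ℝ) : |walsh n x| = 1 := abs_walshSet _ _

@[fun_prop]
lemma measurable_walshSet (S : Finset ℕ) : Measurable (walshSet S) := by
  unfold walshSet
  fun_prop

@[fun_prop]
lemma measurable_walsh (n : ℕ) : Measurable (walsh n) := measurable_walshSet _

lemma walshSet_union {S U : Finset ℕ} (h : Disjoint S U) (x : ℝ) :
    walshSet (S ∪ U) x = walshSet S x * walshSet U x :=
  Finset.prod_union h

lemma walshSet_mul (S U : Finset ℕ) (x : ℝ) :
    walshSet S x * walshSet U x = walshSet (symmDiff S U) x := by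
  have hS : walshSet S x = walshSet (S \ U) x * walshSet (S ∩ U) x := by
    rw [← walshSet_union (Finset.disjoint_sdiff_inter S U), Finset.sdiff_union_inter]
  have hU : walshSet U x = walshSet (U \ S) x * walshSet (S ∩ U) x := by
    rw [Finset.inter_comm, ← walshSet_union (Finset.disjoint_sdiff_inter U S),
      Finset.sdiff_union_inter]
  have hd : walshSet (symmDiff S U) x = walshSet (S \ U) x * walshSet (U \ S) x :=
    walshSet_union disjoint_sdiff_sdiff x
  rw [hS, hU, hd]
  linear_combination walshSet (S \ U) x * walshSet (U \ S) x * walshSet_mul_self (S ∩ U) x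

/-- Translation by `2^{-(k+1)}`, with `k` the least element of `S`, changes the sign of the
`1`-periodic function `walshSet S`; so its integral over a period vanishes. -/
lemma integral_walshSet_of_nonempty {S : Finset ℕ} (hS : S.Nonempty) :
    ∫ x in Set.Icc (0 : ℝ) 1, walshSet S x = 0 := by
  set t : ℝ := (1 / 2) / 2 ^ (S.min' hS) with ht
  have hper : Function.Periodic (walshSet S) 1 := by
    intro x
    refine Finset.prod_congr rfl fun k _ => ?_
    have := rademacherZero_add_int (2 ^ k * x) (2 ^ k)
    push_cast at this
    rw [rademacher, rademacher, mul_add, mul_one, this]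
  have hneg : ∀ x, walshSet S (x + t) = -walshSet S x := by
    intro x
    unfold walshSet
    rw [← Finset.mul_prod_erase _ _ (S.min'_mem hS), ← Finset.mul_prod_erase _ _ (S.min'_mem hS),
      neg_mul_eq_neg_mul]
    congr 1
    · have : 2 ^ S.min' hS * (x + t) = 2 ^ S.min' hS * x + 1 / 2 := by
        rw [ht]; field_simp
      rw [rademacher, rademacher, this, rademacherZero_add_half]
    · refine Finset.prod_congr rfl fun k hk => ?_
      have hlt : S.min' hS < k :=
        lt_of_le_of_ne (S.min'_le k (Finset.mem_of_mem_erase hk)) (Finset.ne_of_mem_erase hk).symm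
      obtain ⟨j, rfl⟩ := Nat.exists_eq_add_of_lt hlt
      have := rademacherZero_add_int (2 ^ (S.min' hS + j + 1) * x) (2 ^ j)
      have h2 : 2 ^ (S.min' hS + j + 1) * (x + t) =
          2 ^ (S.min' hS + j + 1) * x + ((2 ^ j : ℤ) : ℝ) := by
        rw [ht]; push_cast; field_simp; ring
      rw [rademacher, rademacher, h2, this]
  have h1 : ∫ x in (0 : ℝ)..1, walshSet S (x + t) = ∫ x in (0 : ℝ)..1, walshSet S x := by
    rw [intervalIntegral.integral_comp_add_right]
    have := hper.intervalIntegral_add_eq t 0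
    rw [zero_add] at this
    rw [← this, zero_add, add_comm]
  simp only [hneg, intervalIntegral.integral_neg] at h1
  rw [integral_Icc_eq_integral_Ioc, ← intervalIntegral.integral_of_le zero_le_one]
  linarith

lemma integral_walshSet (S : Finset ℕ) :
    ∫ x in Set.Icc (0 : ℝ) 1, walshSet S x = if S = ∅ then 1 else 0 := by
  split_ifs with h
  · simp [h, walshSet]
  · exact integral_walshSet_of_nonempty (Finset.nonempty_iff_ne_empty.mpr h)

lemma integral_walsh_mul_walsh (n k : ℕ) :
    ∫ x in Set.Icc (0 : ℝ) 1, walsh n x * walsh k x = if n = k then 1 else 0 := by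
  simp_rw [walsh_eq_walshSet, walshSet_mul, integral_walshSet]
  have : symmDiff (Finset.equivBitIndices n) (Finset.equivBitIndices k) = ∅ ↔ n = k := by
    rw [← Finset.bot_eq_empty, symmDiff_eq_bot, EmbeddingLike.apply_eq_iff_eq]
  simp only [this]

/-! ### Integration over the square -/

lemma volume_restrict_T : (volume : Measure (ℝ × ℝ)).restrict T =
    (volume.restrict (Set.Icc (0 : ℝ) 1)).prod (volume.restrict (Set.Icc (0 : ℝ) 1)) := by
  rw [Measure.prod_restrict, T, Measure.volume_eq_prod]

instance : IsProbabilityMeasure ((volume : Measure (ℝ × ℝ)).restrict T) := by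
  rw [volume_restrict_T]
  have : IsProbabilityMeasure ((volume : Measure ℝ).restrict (Set.Icc (0 : ℝ) 1)) :=
    ⟨by simp⟩
  infer_instance

/-- The sum over `C` of the terms of the double Walsh series with coefficients `d`. -/
noncomputable def partialSum (d : ℕ × ℕ → ℝ) (C : Finset (ℕ × ℕ)) (z : ℝ × ℝ) : ℝ :=
  ∑ i ∈ C, d i * walsh i.1 z.1 * walsh i.2 z.2

@[fun_prop]
lemma measurable_partialSum (d : ℕ × ℕ → ℝ) (C : Finset (ℕ × ℕ)) :
    Measurable (partialSum d C) := by
  unfold partialSum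
  fun_prop

lemma abs_partialSum_le (d : ℕ × ℕ → ℝ) (C : Finset (ℕ × ℕ)) (z : ℝ × ℝ) :
    |partialSum d C z| ≤ ∑ i ∈ C, |d i| := by
  refine (Finset.abs_sum_le_sum_abs _ _).trans (Finset.sum_le_sum fun i _ => ?_)
  simp [abs_mul, abs_walsh]

lemma integrable_of_measurable_of_bound {g : ℝ × ℝ → ℝ} (hg : Measurable g) {M : ℝ}
    (h : ∀ z, |g z| ≤ M) : Integrable g (volume.restrict T) :=
  Integrable.of_bound hg.aestronglyMeasurable M (Eventually.of_forall h)

lemma integrable_partialSum (d : ℕ × ℕ → ℝ) (C : Finset (ℕ × ℕ)) :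
    Integrable (partialSum d C) (volume.restrict T) :=
  integrable_of_measurable_of_bound (by fun_prop) (abs_partialSum_le d C)

lemma setIntegral_T_mul (f g : ℝ → ℝ) : ∫ z in T, f z.1 * g z.2 =
    (∫ x in Set.Icc (0 : ℝ) 1, f x) * ∫ y in Set.Icc (0 : ℝ) 1, g y := by
  rw [volume_restrict_T, integral_prod_mul]

lemma integral_partialSum_mul_walsh (d : ℕ × ℕ → ℝ) (C : Finset (ℕ × ℕ)) (j : ℕ × ℕ) :
    ∫ z in T, partialSum d C z * (walsh j.1 z.1 * walsh j.2 z.2) = if j ∈ C then d j else 0 := by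
  unfold partialSum
  simp_rw [Finset.sum_mul]
  rw [integral_finsetSum]
  · have : ∀ i ∈ C, ∫ z in T, d i * walsh i.1 z.1 * walsh i.2 z.2 *
        (walsh j.1 z.1 * walsh j.2 z.2) = if j = i then d i else 0 := by
      intro i _
      have h : ∀ z : ℝ × ℝ, d i * walsh i.1 z.1 * walsh i.2 z.2 *
        (walsh j.1 z.1 * walsh j.2 z.2) =
          d i * ((walsh i.1 z.1 * walsh j.1 z.1) * (walsh i.2 z.2 * walsh j.2 z.2)) :=
        fun z => by ring
      simp_rw [h]
      rw [integral_const_mul, setIntegral_T_mul (fun x => walsh i.1 x * walsh j.1 x)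
        (fun x => walsh i.2 x * walsh j.2 x), integral_walsh_mul_walsh, integral_walsh_mul_walsh]
      simp only [Prod.ext_iff, eq_comm (a := j.1), eq_comm (a := j.2)]
      split_ifs <;> simp_all
    rw [Finset.sum_congr rfl this, Finset.sum_ite_eq]
  · intro i _
    refine integrable_of_measurable_of_bound (M := |d i|) (by fun_prop) fun z => ?_
    simp [abs_mul, abs_walsh]

lemma integral_partialSum_sq (d : ℕ × ℕ → ℝ) (C : Finset (ℕ × ℕ)) :
    ∫ z in T, partialSum d C z ^ 2 = ∑ i ∈ C, d i ^ 2 := by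
  have h : ∀ z, partialSum d C z ^ 2 =
      ∑ i ∈ C, d i * (partialSum d C z * (walsh i.1 z.1 * walsh i.2 z.2)) := by
    intro z
    rw [sq]
    nth_rewrite 2 [partialSum]
    rw [Finset.mul_sum]
    exact Finset.sum_congr rfl fun i _ => by ring
  simp_rw [h]
  rw [integral_finsetSum]
  · refine Finset.sum_congr rfl fun i hi => ?_
    rw [integral_const_mul, integral_partialSum_mul_walsh, if_pos hi, sq]
  · intro i _
    refine Integrable.const_mul (integrable_of_measurable_of_bound
      (M := ∑ i ∈ C, |d i|) (by fun_prop) fun z => ?_) _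
    simpa [abs_mul, abs_walsh] using abs_partialSum_le d C z

/-- By orthonormality, the `L¹` norm of a Walsh polynomial is at most the `ℓ²` norm of its
coefficients. -/
lemma lintegral_abs_partialSum_le {d : ℕ × ℕ → ℝ} {C : Finset (ℕ × ℕ)} {η : ℝ} (hη : 0 < η)
    (h : ∑ i ∈ C, d i ^ 2 ≤ η ^ 2) :
    ∫⁻ z in T, ENNReal.ofReal |partialSum d C z| ≤ ENNReal.ofReal η := by
  rw [← ofReal_integral_eq_lintegral_ofReal (integrable_partialSum d C).abs
    (Eventually.of_forall fun _ => abs_nonneg _)]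
  refine ENNReal.ofReal_le_ofReal ?_
  have hsq : Integrable (fun z => partialSum d C z ^ 2) (volume.restrict T) :=
    integrable_of_measurable_of_bound (M := (∑ i ∈ C, |d i|) ^ 2) (by fun_prop) fun z => by
      rw [abs_pow]
      exact pow_le_pow_left₀ (abs_nonneg _) (abs_partialSum_le d C z) 2
  -- The inequality `2 η |P| ≤ P² + η²` takes the place of the Cauchy-Schwarz inequality.
  calc ∫ z in T, |partialSum d C z|
      ≤ ∫ z in T, ((2 * η)⁻¹ * partialSum d C z ^ 2 + η / 2) := by
        refine integral_mono (integrable_partialSum d C).abs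
          ((hsq.const_mul _).add (integrable_const _)) fun z => ?_
        have h1 := sq_nonneg (|partialSum d C z| - η)
        have h2 : |partialSum d C z| ^ 2 = partialSum d C z ^ 2 := sq_abs _
        have : |partialSum d C z| * (2 * η) ≤ partialSum d C z ^ 2 + η / 2 * (2 * η) := by
          nlinarith
        change |partialSum d C z| ≤ (2 * η)⁻¹ * partialSum d C z ^ 2 + η / 2
        rw [← mul_le_mul_iff_left₀ (by positivity : 0 < 2 * η)]
        refine this.trans_eq ?_
        field_simp
    _ = (2 * η)⁻¹ * (∑ i ∈ C, d i ^ 2) + η / 2 := by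
        rw [integral_add (hsq.const_mul _) (integrable_const _), integral_const_mul,
          integral_partialSum_sq]
        simp
    _ ≤ (2 * η)⁻¹ * η ^ 2 + η / 2 := by gcongr
    _ = η := by field_simp; ring

/-! ### Dyadic cells and bricks -/

/-- The set of the positions below `p` at which the Rademacher function at `x` is `-1`. For
`x ∈ [0, 1)` these are the ones among the first `p` binary digits of `x`, so `binDigits p x`
labels the dyadic interval of length `2^{-p}` that contains `x`. -/
noncomputable def binDigits (p : ℕ) (x : ℝ) : Finset ℕ :=
  (Finset.range p).filter fun k => rademacher k x = -1

lemma binDigits_subset (p : ℕ) (x : ℝ) : binDigits p x ⊆ Finset.range p :=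
  Finset.filter_subset _ _

lemma binDigits_inter_range {p q : ℕ} (h : p ≤ q) (x : ℝ) :
    binDigits q x ∩ Finset.range p = binDigits p x := by
  ext k
  simp only [binDigits, Finset.mem_inter, Finset.mem_filter, Finset.mem_range]
  constructor
  · rintro ⟨⟨_, h1⟩, h2⟩
    exact ⟨h2, h1⟩
  · rintro ⟨h1, h2⟩
    exact ⟨⟨h1.trans_le h, h2⟩, h1⟩

/-- The value at `k` of the sign pattern that is `-1` exactly on `S`. -/
noncomputable def signAt (S : Finset ℕ) (k : ℕ) : ℝ := if k ∈ S then -1 else 1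

lemma signAt_eq_one_or (S : Finset ℕ) (k : ℕ) : signAt S k = 1 ∨ signAt S k = -1 := by
  unfold signAt
  split_ifs <;> simp

lemma abs_prod_signAt (S P : Finset ℕ) : |∏ k ∈ P, signAt S k| = 1 := by
  rw [Finset.abs_prod]
  refine Finset.prod_eq_one fun k _ => ?_
  rcases signAt_eq_one_or S k with h | h <;> simp [h]

/-- A product of factors `1 + a b` with signs `a`, `b` detects whether all signs agree. -/
lemma prod_one_add_mul_of_sign {ι : Type*} (K : Finset ι) (a b : ι → ℝ)
    (ha : ∀ k, a k = 1 ∨ a k = -1) (hb : ∀ k, b k = 1 ∨ b k = -1)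
    [Decidable (∀ k ∈ K, a k = b k)] :
    ∏ k ∈ K, (1 + a k * b k) = if ∀ k ∈ K, a k = b k then 2 ^ K.card else 0 := by
  split_ifs with h
  · rw [← Finset.prod_const]
    refine Finset.prod_congr rfl fun k hk => ?_
    rw [h k hk]
    rcases hb k with h | h <;> norm_num [h]
  · push Not at h
    obtain ⟨k, hk, hne⟩ := h
    refine Finset.prod_eq_zero hk ?_
    rcases ha k with h1 | h1 <;> rcases hb k with h2 | h2 <;> simp_all

lemma forall_signAt_eq_iff {p : ℕ} {S : Finset ℕ} (hS : S ⊆ Finset.range p) (x : ℝ) :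
    (∀ k ∈ Finset.range p, signAt S k = rademacher k x) ↔ binDigits p x = S := by
  constructor
  · intro h
    ext k
    simp only [binDigits, Finset.mem_filter]
    constructor
    · rintro ⟨hk, h1⟩
      by_contra hc
      have := h k hk
      rw [h1, signAt, if_neg hc] at this
      norm_num at this
    · intro hk
      refine ⟨hS hk, ?_⟩
      rw [← h k (hS hk), signAt, if_pos hk]
  · rintro rfl k hk
    unfold signAt
    rcases rademacher_eq_one_or k x with h | h
    · have : k ∉ binDigits p x := by
        simp only [binDigits, Finset.mem_filter, h]
        norm_num
      rw [if_neg this, h]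
    · have : k ∈ binDigits p x := Finset.mem_filter.mpr ⟨hk, h⟩
      rw [if_pos this, h]

lemma prod_one_add_signAt {p : ℕ} {S : Finset ℕ} (hS : S ⊆ Finset.range p) (x : ℝ) :
    ∏ k ∈ Finset.range p, (1 + signAt S k * rademacher k x) =
      if binDigits p x = S then 2 ^ p else 0 := by
  classical
  rw [prod_one_add_mul_of_sign _ _ _ (signAt_eq_one_or S) (fun k => rademacher_eq_one_or k x),
    Finset.card_range]
  exact if_congr (forall_signAt_eq_iff hS x) rfl rfl

lemma prod_one_add_signAt_eq_sum (p : ℕ) (S : Finset ℕ) (x : ℝ) :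
    ∏ k ∈ Finset.range p, (1 + signAt S k * rademacher k x) =
      ∑ P ∈ (Finset.range p).powerset, (∏ k ∈ P, signAt S k) * walshSet P x := by
  rw [Finset.prod_one_add]
  simp_rw [Finset.prod_mul_distrib, walshSet]

lemma integral_prod_one_add_signAt (p : ℕ) (S : Finset ℕ) :
    ∫ x in Set.Icc (0 : ℝ) 1, ∏ k ∈ Finset.range p, (1 + signAt S k * rademacher k x) = 1 := by
  simp_rw [prod_one_add_signAt_eq_sum]
  rw [integral_finsetSum]
  · simp_rw [integral_const_mul, integral_walshSet]
    simp
  · intro P _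
    refine Integrable.const_mul ?_ _
    exact Integrable.of_bound (measurable_walshSet P).aestronglyMeasurable 1
      (Eventually.of_forall fun x => (abs_walshSet P x).le)

/-- The indices of the Walsh functions that occur in a brick: the digits of both indices agree from
position `s` on, where they form a nonempty subset of `[s, s + m)`, and the remaining digits are
arbitrary below `p`. -/
noncomputable def brickIndex (t : Finset ℕ × Finset ℕ × Finset ℕ) : ℕ × ℕ :=
  (Finset.equivBitIndices.symm (t.2.2 ∪ t.1), Finset.equivBitIndices.symm (t.2.2 ∪ t.2.1))

/-- The triples that parametrize, through `brickIndex`, the spectrum of a brick. -/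
def brickTriples (p s m : ℕ) : Finset (Finset ℕ × Finset ℕ × Finset ℕ) :=
  (Finset.range p).powerset ×ˢ (Finset.range p).powerset ×ˢ
    ((Finset.Ico s (s + m)).powerset.erase ∅)

lemma mem_brickTriples {p s m : ℕ} {t : Finset ℕ × Finset ℕ × Finset ℕ} :
    t ∈ brickTriples p s m ↔ t.1 ⊆ Finset.range p ∧ t.2.1 ⊆ Finset.range p ∧
      t.2.2 ≠ ∅ ∧ t.2.2 ⊆ Finset.Ico s (s + m) := by
  simp [brickTriples]

lemma card_brickTriples_le (p s m : ℕ) : (brickTriples p s m).card ≤ 4 ^ p * 2 ^ m := by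
  rw [brickTriples, Finset.card_product, Finset.card_product, Finset.card_powerset,
    Finset.card_range, ← mul_assoc, ← mul_pow]
  refine Nat.mul_le_mul (by norm_num) ((Finset.card_erase_le).trans ?_)
  simp

lemma inter_range_of_subset_Ico {p s n : ℕ} (hp : p ≤ s) {U P : Finset ℕ}
    (hU : U ⊆ Finset.Ico s n) (hP : P ⊆ Finset.range p) : (U ∪ P) ∩ Finset.range p = P := by
  ext k
  simp only [Finset.mem_inter, Finset.mem_union, Finset.mem_range]
  constructor
  · rintro ⟨h | h, hk⟩
    · have := Finset.mem_Ico.mp (hU h)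
      omega
    · exact h
  · intro h
    exact ⟨Or.inr h, Finset.mem_range.mp (hP h)⟩

lemma sdiff_range_of_subset_Ico {p s n : ℕ} (hp : p ≤ s) {U P : Finset ℕ}
    (hU : U ⊆ Finset.Ico s n) (hP : P ⊆ Finset.range p) : (U ∪ P) \ Finset.range p = U := by
  ext k
  simp only [Finset.mem_sdiff, Finset.mem_union, Finset.mem_range]
  constructor
  · rintro ⟨h | h, hk⟩
    · exact h
    · exact absurd (Finset.mem_range.mp (hP h)) hk
  · intro h
    have := Finset.mem_Ico.mp (hU h)
    exact ⟨Or.inl h, by omega⟩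

lemma brickIndex_injOn {p s : ℕ} (hp : p ≤ s) (m : ℕ) :
    Set.InjOn brickIndex (brickTriples p s m) := by
  rintro ⟨P, Q, U⟩ h ⟨P', Q', U'⟩ h' he
  obtain ⟨hP, hQ, -, hU⟩ := mem_brickTriples.mp (Finset.mem_coe.mp h)
  obtain ⟨hP', hQ', -, hU'⟩ := mem_brickTriples.mp (Finset.mem_coe.mp h')
  simp only [brickIndex, Prod.mk.injEq, EmbeddingLike.apply_eq_iff_eq] at he hP hQ hU hP' hQ' hU'
  have e1 := congrArg (· ∩ Finset.range p) he.1
  have e2 := congrArg (· ∩ Finset.range p) he.2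
  have e3 := congrArg (· \ Finset.range p) he.1
  simp only [inter_range_of_subset_Ico hp hU hP, inter_range_of_subset_Ico hp hU' hP'] at e1
  simp only [inter_range_of_subset_Ico hp hU hQ, inter_range_of_subset_Ico hp hU' hQ'] at e2
  simp only [sdiff_range_of_subset_Ico hp hU hP, sdiff_range_of_subset_Ico hp hU' hP'] at e3
  rw [e1, e2, e3]

lemma equivBitIndices_symm_bounds {p s m : ℕ} (hp : p ≤ s) {U P : Finset ℕ} (h0 : U ≠ ∅)
    (hU : U ⊆ Finset.Ico s (s + m)) (hP : P ⊆ Finset.range p) :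
    2 ^ s ≤ Finset.equivBitIndices.symm (U ∪ P) ∧
      Finset.equivBitIndices.symm (U ∪ P) < 2 ^ (s + m) := by
  rw [Finset.equivBitIndices_symm_apply]
  constructor
  · obtain ⟨k, hk⟩ := Finset.nonempty_iff_ne_empty.mpr h0
    calc 2 ^ s ≤ 2 ^ k := Nat.pow_le_pow_right two_pos (Finset.mem_Ico.mp (hU hk)).1
      _ ≤ _ := Finset.single_le_sum (f := fun k => 2 ^ k) (fun _ _ => Nat.zero_le _)
          (Finset.mem_union_left _ hk)
  · refine Nat.geomSum_lt le_rfl fun k hk => ?_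
    rcases Finset.mem_union.mp hk with h | h
    · exact (Finset.mem_Ico.mp (hU h)).2
    · have := Finset.mem_range.mp (hP h)
      omega

/-- The coefficients of a brick: the Walsh polynomial equal to `γ` times the indicator of the cell
`(S, S')` of level `p` times `1 - ∏_{s ≤ k < s + m} (1 + r_k(x) r_k(y))`. -/
noncomputable def brickCoeff (γ : ℝ) (p s m : ℕ) (S S' : Finset ℕ) (i : ℕ × ℕ) : ℝ :=
  if i ∈ (brickTriples p s m).image brickIndex then
    -(γ / 4 ^ p) * (∏ k ∈ Finset.equivBitIndices i.1 ∩ Finset.range p, signAt S k) *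
      ∏ k ∈ Finset.equivBitIndices i.2 ∩ Finset.range p, signAt S' k
  else 0

lemma partialSum_brickCoeff (γ : ℝ) {p s : ℕ} (hp : p ≤ s) (m : ℕ) (S S' : Finset ℕ)
    (z : ℝ × ℝ) :
    partialSum (brickCoeff γ p s m S S') ((brickTriples p s m).image brickIndex) z =
      γ / 4 ^ p * (∏ k ∈ Finset.range p, (1 + signAt S k * rademacher k z.1)) *
        (∏ k ∈ Finset.range p, (1 + signAt S' k * rademacher k z.2)) *
        (1 - ∏ k ∈ Finset.Ico s (s + m), (1 + rademacher k z.1 * rademacher k z.2)) := by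
  have hU : ∏ k ∈ Finset.Ico s (s + m), (1 + rademacher k z.1 * rademacher k z.2) - 1 =
      ∑ U ∈ (Finset.Ico s (s + m)).powerset.erase ∅, walshSet U z.1 * walshSet U z.2 := by
    rw [Finset.sum_erase_eq_sub (Finset.empty_mem_powerset _), Finset.prod_one_add]
    simp_rw [Finset.prod_mul_distrib, walshSet]
    simp
  have h1 : partialSum (brickCoeff γ p s m S S') ((brickTriples p s m).image brickIndex) z =
      ∑ t ∈ brickTriples p s m, -(γ / 4 ^ p) * (((∏ k ∈ t.1, signAt S k) * walshSet t.1 z.1) *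
        (((∏ k ∈ t.2.1, signAt S' k) * walshSet t.2.1 z.2) *
          (walshSet t.2.2 z.1 * walshSet t.2.2 z.2))) := by
    rw [partialSum, Finset.sum_image (brickIndex_injOn hp m)]
    refine Finset.sum_congr rfl fun t ht => ?_
    obtain ⟨hP, hQ, -, hU⟩ := mem_brickTriples.mp ht
    have d1 : ∀ {P : Finset ℕ}, P ⊆ Finset.range p → Disjoint t.2.2 P := by
      intro P hP
      rw [Finset.disjoint_left]
      intro k hk hk'
      have := Finset.mem_Ico.mp (hU hk)
      have := Finset.mem_range.mp (hP hk')
      omega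
    rw [brickCoeff, if_pos (Finset.mem_image_of_mem _ ht)]
    simp only [walsh_eq_walshSet, brickIndex, Equiv.apply_symm_apply,
      inter_range_of_subset_Ico hp hU hP, inter_range_of_subset_Ico hp hU hQ,
      walshSet_union (d1 hP), walshSet_union (d1 hQ)]
    ring
  rw [h1, ← neg_sub, hU, prod_one_add_signAt_eq_sum, prod_one_add_signAt_eq_sum, brickTriples,
    ← Finset.mul_sum]
  simp_rw [Finset.sum_product, ← Finset.mul_sum, ← Finset.sum_mul]
  ring

/-- A brick: a Walsh polynomial with spectrum in `[2^s, 2^{s+m})²` and small coefficients that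
coincides with the multiple `γ` of the indicator of a cell outside of a small set. -/
theorem exists_brick (γ : ℝ) {p s : ℕ} (hp : p ≤ s) (m : ℕ) {S S' : Finset ℕ}
    (hS : S ⊆ Finset.range p) (hS' : S' ⊆ Finset.range p) :
    ∃ (d : ℕ × ℕ → ℝ) (I : Finset (ℕ × ℕ)) (bad : Set (ℝ × ℝ)),
      (∀ i ∈ I, (2 ^ s ≤ i.1 ∧ i.1 < 2 ^ (s + m)) ∧ 2 ^ s ≤ i.2 ∧ i.2 < 2 ^ (s + m)) ∧
      (∀ i ∉ I, d i = 0) ∧ (∀ i ∈ I, |d i| = |γ| / 4 ^ p) ∧ I.card ≤ 4 ^ p * 2 ^ m ∧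
      MeasurableSet bad ∧ volume.restrict T bad ≤ ENNReal.ofReal ((4 ^ p * 2 ^ m)⁻¹) ∧
      ∀ z ∉ bad, partialSum d I z =
        if binDigits p z.1 = S ∧ binDigits p z.2 = S' then γ else 0 := by
  set a : ℝ → ℝ := fun x => ∏ k ∈ Finset.range p, (1 + signAt S k * rademacher k x) with ha
  set b : ℝ → ℝ := fun x => ∏ k ∈ Finset.range p, (1 + signAt S' k * rademacher k x) with hb
  set e : ℝ × ℝ → ℝ := fun z =>
    ∏ k ∈ Finset.Ico s (s + m), (1 + rademacher k z.1 * rademacher k z.2) with he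
  have hae : ∀ x, a x = if binDigits p x = S then 2 ^ p else 0 := prod_one_add_signAt hS
  have hbe : ∀ x, b x = if binDigits p x = S' then 2 ^ p else 0 := prod_one_add_signAt hS'
  have hee : ∀ z, e z = 2 ^ m ∨ e z = 0 := by
    classical
    intro z
    have := prod_one_add_mul_of_sign (Finset.Ico s (s + m)) (fun k => rademacher k z.1)
      (fun k => rademacher k z.2) (fun k => rademacher_eq_one_or k _)
      (fun k => rademacher_eq_one_or k _)
    simp only [he, this]
    split_ifs <;> simp
  have ham : Measurable a := by simp only [ha]; fun_prop
  have hbm : Measurable b := by simp only [hb]; fun_prop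
  have hem : Measurable e := by simp only [he]; fun_prop
  have hps := fun γ => partialSum_brickCoeff γ hp m S S'
  have habs : ∀ z : ℝ × ℝ, |a z.1 * b z.2| ≤ 4 ^ p := by
    intro z
    have h4 : (4 : ℝ) ^ p = 2 ^ p * 2 ^ p := by rw [← mul_pow]; norm_num
    rw [hae, hbe, h4]
    split_ifs <;> simp [abs_mul]
  have hbadm : MeasurableSet {z : ℝ × ℝ | a z.1 * b z.2 * e z ≠ 0} := by
    have : Measurable fun z : ℝ × ℝ => a z.1 * b z.2 * e z := by fun_prop
    exact (measurableSet_eq_fun this measurable_const).compl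
  have hspec : ∀ i ∈ (brickTriples p s m).image brickIndex,
      (2 ^ s ≤ i.1 ∧ i.1 < 2 ^ (s + m)) ∧ 2 ^ s ≤ i.2 ∧ i.2 < 2 ^ (s + m) := by
    intro i hi
    obtain ⟨t, ht, rfl⟩ := Finset.mem_image.mp hi
    obtain ⟨hP, hQ, h0, hU⟩ := mem_brickTriples.mp ht
    exact ⟨equivBitIndices_symm_bounds hp h0 hU hP, equivBitIndices_symm_bounds hp h0 hU hQ⟩
  -- The brick has mean value zero, so `a b e` has the same integral as `a b`.
  have hint : ∫ z in T, a z.1 * b z.2 * e z = 1 := by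
    have h1 : ∀ z : ℝ × ℝ, a z.1 * b z.2 * e z = a z.1 * b z.2 -
        partialSum (brickCoeff (4 ^ p) p s m S S') ((brickTriples p s m).image brickIndex) z *
          (walsh 0 z.1 * walsh 0 z.2) := by
      intro z
      have h4 : (4 : ℝ) ^ p / 4 ^ p = 1 := div_self (by positivity)
      rw [hps, h4]
      simp only [ha, hb, he, walsh, Nat.bitIndices_zero, List.toFinset_nil, Finset.prod_empty]
      ring
    have h0 : ((0 : ℕ), (0 : ℕ)) ∉ (brickTriples p s m).image brickIndex := by
      intro h
      have := (hspec _ h).1.1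
      simp at this
    simp_rw [h1]
    rw [integral_sub, setIntegral_T_mul, integral_partialSum_mul_walsh _ _ (0, 0), if_neg h0,
      integral_prod_one_add_signAt, integral_prod_one_add_signAt]
    · norm_num
    · exact integrable_of_measurable_of_bound (by fun_prop) habs
    · have := integrable_partialSum (brickCoeff (4 ^ p) p s m S S')
        ((brickTriples p s m).image brickIndex)
      simpa [walsh] using this
  refine ⟨brickCoeff γ p s m S S', (brickTriples p s m).image brickIndex,
    {z | a z.1 * b z.2 * e z ≠ 0}, hspec, fun i hi => by rw [brickCoeff, if_neg hi],
    fun i hi => ?_, Finset.card_image_le.trans (card_brickTriples_le p s m), hbadm, ?_,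
    fun z hz => ?_⟩
  · rw [brickCoeff, if_pos hi, abs_mul, abs_mul, abs_prod_signAt, abs_prod_signAt, abs_neg, abs_div]
    simp
  · have hind : ∀ z, a z.1 * b z.2 * e z =
        (4 ^ p * 2 ^ m) * Set.indicator {z : ℝ × ℝ | a z.1 * b z.2 * e z ≠ 0} 1 z := by
      intro z
      have h4 : (4 : ℝ) ^ p = 2 ^ p * 2 ^ p := by rw [← mul_pow]; norm_num
      by_cases h : a z.1 * b z.2 * e z = 0
      · rw [Set.indicator_of_notMem (fun hc => absurd h hc), h, mul_zero]
      · rw [Set.indicator_of_mem (by exact h), Pi.one_apply, mul_one]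
        have h2 := hee z
        have h3 := hae z.1
        have h5 := hbe z.2
        have ha0 : a z.1 ≠ 0 := fun h' => h (by rw [h']; ring)
        have hb0 : b z.2 ≠ 0 := fun h' => h (by rw [h']; ring)
        have he0 : e z ≠ 0 := fun h' => h (by rw [h']; ring)
        rw [if_pos (by by_contra hc; rw [if_neg hc] at h3; exact ha0 h3)] at h3
        rw [if_pos (by by_contra hc; rw [if_neg hc] at h5; exact hb0 h5)] at h5
        rw [h3, h5, h2.resolve_right he0, h4]
    rw [integral_congr_ae (Eventually.of_forall hind), integral_const_mul, integral_indicator_one hbadm] at hint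
    rw [← ofReal_measureReal]
    refine ENNReal.ofReal_le_ofReal (le_of_eq ?_)
    rw [eq_inv_of_mul_eq_one_right hint]
  · replace hz := not_not.mp hz
    have h4 : (4 : ℝ) ^ p = 2 ^ p * 2 ^ p := by rw [← mul_pow]; norm_num
    have : partialSum (brickCoeff γ p s m S S') ((brickTriples p s m).image brickIndex) z =
        γ / 4 ^ p * (a z.1 * b z.2) := by
      rw [hps]
      linear_combination (-(γ / 4 ^ p)) * hz
    rw [this, hae, hbe, h4]
    split_ifs with h1 h2 h3 h3 <;> first | (exfalso; tauto) | skip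
    · field_simp
    all_goals simp

/-! ### Correction of step functions on small sets -/

/-- The condition on a finite set of indices shared by rectangular and spherical truncation: with
each `i` it contains all pairs of positive integers below `i`. -/
def IsLowerIndexSet (C : Finset (ℕ × ℕ)) : Prop :=
  ∀ i ∈ C, ∀ j : ℕ × ℕ, 1 ≤ j.1 → 1 ≤ j.2 → j.1 ≤ i.1 → j.2 ≤ i.2 → j ∈ C

/-- The square block `[a, b)²` of indices. -/
def block (a b : ℕ) : Finset (ℕ × ℕ) := Finset.Ico a b ×ˢ Finset.Ico a b

lemma mem_block {a b : ℕ} {i : ℕ × ℕ} :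
    i ∈ block a b ↔ (a ≤ i.1 ∧ i.1 < b) ∧ a ≤ i.2 ∧ i.2 < b := by
  simp [block]

/-- A truncation does not reach beyond the diagonal position `N`, or it contains all that lies
before `N`. -/
lemma IsLowerIndexSet.cut {C : Finset (ℕ × ℕ)} (hC : IsLowerIndexSet C) (N : ℕ) :
    (∀ i ∈ C, N ≤ i.1 → ¬N ≤ i.2) ∨ ∀ M, 1 ≤ M → block M N ⊆ C := by
  by_cases h : ∀ i ∈ C, N ≤ i.1 → ¬N ≤ i.2
  · exact Or.inl h
  · push Not at h
    obtain ⟨i, hi, h1, h2⟩ := h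
    refine Or.inr fun M hM j hj => ?_
    have := mem_block.mp hj
    exact hC i hi j (by omega) (by omega) (by omega) (by omega)

lemma partialSum_eq_of_subset {d : ℕ × ℕ → ℝ} {C I : Finset (ℕ × ℕ)} (h : I ⊆ C)
    (hd : ∀ i ∉ I, d i = 0) (z : ℝ × ℝ) : partialSum d C z = partialSum d I z :=
  (Finset.sum_subset h fun i _ hi => by simp [hd i hi]).symm

lemma partialSum_eq_zero {d : ℕ × ℕ → ℝ} {C : Finset (ℕ × ℕ)} (h : ∀ i ∈ C, d i = 0)
    (z : ℝ × ℝ) : partialSum d C z = 0 :=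
  Finset.sum_eq_zero fun i hi => by simp [h i hi]

lemma partialSum_add (d d' : ℕ × ℕ → ℝ) (C : Finset (ℕ × ℕ)) (z : ℝ × ℝ) :
    partialSum (d + d') C z = partialSum d C z + partialSum d' C z := by
  simp [partialSum, add_mul, Finset.sum_add_distrib]

/-- The labels of the two dyadic intervals of level `p` that contain the coordinates of `z`. -/
noncomputable def cellLabel (p : ℕ) (z : ℝ × ℝ) : Finset ℕ × Finset ℕ :=
  (binDigits p z.1, binDigits p z.2)

/-- Bricks with spectra one after the other along the diagonal, one for each cell in `D`. A
truncation of their sum consists of complete bricks, equal to a restriction of the step function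
outside of the bad sets, and of a part of one brick, which is small in `L²`. -/
theorem exists_sum_bricks {p m : ℕ} {g : Finset ℕ × Finset ℕ → ℝ} {G η q : ℝ} (hη : 0 < η)
    (hg : ∀ t, |g t| ≤ G) (hG : G ^ 2 * 2 ^ m / 4 ^ p ≤ η ^ 2) (hq : 0 < q) {N₀ : ℕ}
    (hN₀ : 1 ≤ N₀) (D : Finset (Finset ℕ × Finset ℕ))
    (hD : ∀ t ∈ D, t.1 ⊆ Finset.range p ∧ t.2 ⊆ Finset.range p) :
    ∃ (N₁ : ℕ) (d : ℕ × ℕ → ℝ) (bad : Set (ℝ × ℝ)), N₀ ≤ N₁ ∧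
      (∀ i ∉ block N₀ N₁, d i = 0) ∧
      ∑ i ∈ block N₀ N₁, |d i| ^ q ≤ D.card * (4 ^ p * 2 ^ m * (G / 4 ^ p) ^ q) ∧
      MeasurableSet bad ∧
      volume.restrict T bad ≤ D.card * ENNReal.ofReal ((4 ^ p * 2 ^ m)⁻¹) ∧
      (∀ z ∉ bad, partialSum d (block N₀ N₁) z =
        if cellLabel p z ∈ D then g (cellLabel p z) else 0) ∧
      ∀ C, IsLowerIndexSet C → ∃ r : ℝ × ℝ → ℝ, Measurable r ∧
        ∫⁻ z in T, ENNReal.ofReal |r z| ≤ ENNReal.ofReal η ∧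
        ∀ z ∉ bad, |partialSum d C z| ≤
          |if cellLabel p z ∈ D then g (cellLabel p z) else 0| + |r z| := by
  induction D using Finset.induction_on with
  | empty =>
    refine ⟨N₀, 0, ∅, le_rfl, fun _ _ => rfl, by simp [block], MeasurableSet.empty, by simp,
      fun z _ => by simp [partialSum], fun C _ => ⟨0, measurable_const, by simp, fun z _ => ?_⟩⟩
    simp [partialSum]
  | insert t D ht ih =>
    obtain ⟨N₁, d, bad, hN, hd, hdq, hbm, hbv, hdf, hdC⟩ :=
      ih fun t' ht' => hD t' (Finset.mem_insert_of_mem ht')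
    obtain ⟨hS, hS'⟩ := hD t (Finset.mem_insert_self _ _)
    obtain ⟨s, hps, hNs⟩ : ∃ s, p ≤ s ∧ N₁ ≤ 2 ^ s :=
      ⟨max p N₁, le_max_left _ _, (le_max_right p N₁).trans Nat.lt_two_pow_self.le⟩
    obtain ⟨d', I, bad', hI, hd'0, hd'I, hcard, hbm', hbv', hdf'⟩ :=
      exists_brick (g t) hps m hS hS'
    have hNN : N₁ ≤ 2 ^ (s + m) := hNs.trans (Nat.pow_le_pow_right two_pos (Nat.le_add_right _ _))
    have hG0 : 0 ≤ G := (abs_nonneg _).trans (hg t)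
    have hsub : block N₀ N₁ ⊆ block N₀ (2 ^ (s + m)) := fun i hi => by
      have := mem_block.mp hi
      exact mem_block.mpr (by omega)
    have hIsub : I ⊆ block N₀ (2 ^ (s + m)) := fun i hi => by
      have := hI i hi
      exact mem_block.mpr (by omega)
    have hdI : ∀ i ∈ I, d i = 0 := fun i hi => hd i fun hc => by
      have := hI i hi
      have := mem_block.mp hc
      omega
    have hcardR : (I.card : ℝ) ≤ 4 ^ p * 2 ^ m := by exact_mod_cast hcard
    have hmono : ∀ z, |if cellLabel p z ∈ D then g (cellLabel p z) else 0| ≤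
        |if cellLabel p z ∈ insert t D then g (cellLabel p z) else 0| := by
      intro z
      by_cases h : cellLabel p z ∈ D
      · rw [if_pos h, if_pos (Finset.mem_insert_of_mem h)]
      · rw [if_neg h, abs_zero]
        exact abs_nonneg _
    refine ⟨2 ^ (s + m), d + d', bad ∪ bad', hN.trans hNN, fun i hi => ?_, ?_, hbm.union hbm', ?_,
      fun z hz => ?_, fun C hC => ?_⟩
    · rw [Pi.add_apply, hd i (fun h => hi (hsub h)), hd'0 i (fun h => hi (hIsub h)), add_zero]
    · have h1 : ∀ i, |(d + d') i| ^ q ≤ |d i| ^ q + |d' i| ^ q := by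
        intro i
        by_cases hi : i ∈ I
        · rw [Pi.add_apply, hdI i hi, zero_add]
          exact le_add_of_nonneg_left (by positivity)
        · rw [Pi.add_apply, hd'0 i hi, add_zero]
          exact le_add_of_nonneg_right (by positivity)
      have h2 : ∑ i ∈ block N₀ (2 ^ (s + m)), |d i| ^ q = ∑ i ∈ block N₀ N₁, |d i| ^ q :=
        (Finset.sum_subset hsub fun i _ hi => by
          rw [hd i hi, abs_zero, Real.zero_rpow hq.ne']).symm
      have h3 : ∑ i ∈ block N₀ (2 ^ (s + m)), |d' i| ^ q = ∑ i ∈ I, |d' i| ^ q :=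
        (Finset.sum_subset hIsub fun i _ hi => by
          rw [hd'0 i hi, abs_zero, Real.zero_rpow hq.ne']).symm
      have h4 : ∑ i ∈ I, |d' i| ^ q ≤ 4 ^ p * 2 ^ m * (G / 4 ^ p) ^ q := by
        rw [Finset.sum_congr rfl fun i hi => by rw [hd'I i hi], Finset.sum_const, nsmul_eq_mul]
        gcongr
        exact hg t
      rw [Finset.card_insert_of_notMem ht]
      push_cast
      calc _ ≤ ∑ i ∈ block N₀ (2 ^ (s + m)), (|d i| ^ q + |d' i| ^ q) :=
            Finset.sum_le_sum fun i _ => h1 i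
        _ ≤ _ := by
            rw [Finset.sum_add_distrib, h2, h3, add_mul, one_mul]
            exact add_le_add hdq h4
    · rw [Finset.card_insert_of_notMem ht]
      push_cast
      rw [add_mul, one_mul]
      exact (measure_union_le _ _).trans (add_le_add hbv hbv')
    · rw [Set.mem_union, not_or] at hz
      rw [partialSum_add, partialSum_eq_of_subset hsub hd, partialSum_eq_of_subset hIsub hd'0,
        hdf z hz.1, hdf' z hz.2]
      have : (binDigits p z.1 = t.1 ∧ binDigits p z.2 = t.2) ↔ cellLabel p z = t := by
        rw [cellLabel, Prod.ext_iff]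
      simp only [this, Finset.mem_insert]
      by_cases h : cellLabel p z = t
      · simp [h, ht]
      · simp [h]
    · rcases hC.cut N₁ with h | h
      · obtain ⟨r, hrm, hr, hrC⟩ := hdC C hC
        refine ⟨r, hrm, hr, fun z hz => ?_⟩
        rw [Set.mem_union, not_or] at hz
        have h0 : partialSum d' C z = 0 := partialSum_eq_zero (fun i hi => hd'0 i fun hc => by
          have := hI i hc
          exact h i hi (by omega) (by omega)) z
        rw [partialSum_add, h0, add_zero]
        exact (hrC z hz.1).trans (add_le_add (hmono z) le_rfl)
      · refine ⟨partialSum d' C, by fun_prop, lintegral_abs_partialSum_le hη ?_, fun z hz => ?_⟩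
        · have h1 : ∑ i ∈ C, d' i ^ 2 ≤ ∑ i ∈ I, d' i ^ 2 := by
            have : ∑ i ∈ C ∩ I, d' i ^ 2 = ∑ i ∈ C, d' i ^ 2 := by
              refine Finset.sum_subset Finset.inter_subset_left fun i hi hi' => ?_
              rw [hd'0 i fun hc => hi' (Finset.mem_inter.mpr ⟨hi, hc⟩)]
              norm_num
            rw [← this]
            exact Finset.sum_le_sum_of_subset_of_nonneg Finset.inter_subset_right
              fun i _ _ => sq_nonneg _
          have h2 : ∑ i ∈ I, d' i ^ 2 ≤ 4 ^ p * 2 ^ m * (G / 4 ^ p) ^ 2 := by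
            rw [Finset.sum_congr rfl fun i hi => by rw [← sq_abs, hd'I i hi], Finset.sum_const,
              nsmul_eq_mul]
            gcongr
            exact hg t
          refine (h1.trans h2).trans (le_trans (le_of_eq ?_) hG)
          field_simp
        · rw [Set.mem_union, not_or] at hz
          rw [partialSum_add, partialSum_eq_of_subset (h N₀ hN₀) hd, hdf z hz.1]
          exact (abs_add_le _ _).trans (add_le_add (hmono z) le_rfl)

/-- A bounded step function on dyadic cells can be changed on a set of measure at most `δ` into a
Walsh polynomial with spectrum far away, with small coefficients in `ℓ^q` for a given `q > 2`, and
with all truncations dominated, up to a small error, by the step function. -/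
theorem exists_correction (p₀ : ℕ) {g : Finset ℕ × Finset ℕ → ℝ} {G δ q : ℝ}
    (hg : ∀ t, |g t| ≤ G) (hδ : 0 < δ) (hq : 2 < q) {N₀ : ℕ} (hN₀ : 1 ≤ N₀) :
    ∃ (N₁ : ℕ) (d : ℕ × ℕ → ℝ) (bad : Set (ℝ × ℝ)), N₀ < N₁ ∧
      (∀ i ∉ block N₀ N₁, d i = 0) ∧ ∑ i ∈ block N₀ N₁, |d i| ^ q ≤ δ ∧
      MeasurableSet bad ∧ volume.restrict T bad ≤ ENNReal.ofReal δ ∧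
      (∀ z ∉ bad, partialSum d (block N₀ N₁) z = g (cellLabel p₀ z)) ∧
      ∀ C, IsLowerIndexSet C → ∃ r : ℝ × ℝ → ℝ, Measurable r ∧
        ∫⁻ z in T, ENNReal.ofReal |r z| ≤ ENNReal.ofReal δ ∧
        ∀ z ∉ bad, |partialSum d C z| ≤ |g (cellLabel p₀ z)| + |r z| := by
  have hG0 : 0 ≤ G := (abs_nonneg _).trans (hg (∅, ∅))
  obtain ⟨m, hm⟩ : ∃ m : ℕ, ((1 / 2 : ℝ)) ^ m < δ := exists_pow_lt_of_lt_one hδ (by norm_num)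
  obtain ⟨p, hp, hpG, hpq⟩ : ∃ p, p₀ ≤ p ∧ G ^ 2 * 2 ^ m / 4 ^ p ≤ δ ^ 2 ∧
      (4 ^ p : ℝ) * (4 ^ p * 2 ^ m * (G / 4 ^ p) ^ q) ≤ δ := by
    have t1 : Tendsto (fun p : ℕ => G ^ 2 * 2 ^ m / 4 ^ p) atTop (𝓝 0) :=
      tendsto_const_nhds.div_atTop (tendsto_pow_atTop_atTop_of_one_lt (by norm_num))
    have t2 : Tendsto (fun p : ℕ => (4 ^ p : ℝ) * (4 ^ p * 2 ^ m * (G / 4 ^ p) ^ q)) atTop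
        (𝓝 0) := by
      have h4 : (4 : ℝ) ^ (2 - q) < 1 :=
        Real.rpow_lt_one_of_one_lt_of_neg (by norm_num) (by linarith)
      have := (tendsto_pow_atTop_nhds_zero_of_lt_one (by positivity) h4).const_mul (2 ^ m * G ^ q)
      rw [mul_zero] at this
      refine this.congr fun p => ?_
      have h5 : ((4 : ℝ) ^ p) ^ q = (4 ^ q) ^ p := by
        rw [← Real.rpow_natCast, ← Real.rpow_natCast, ← Real.rpow_mul (by norm_num),
          ← Real.rpow_mul (by norm_num), mul_comm]
      rw [Real.div_rpow hG0 (by positivity), h5, Real.rpow_sub (by norm_num), div_pow,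
        Real.rpow_two, ← pow_mul, mul_comm 2 p, pow_mul]
      field_simp
    have e1 := t1.eventually_le_const (show (0 : ℝ) < δ ^ 2 by positivity)
    have e2 := t2.eventually_le_const hδ
    obtain ⟨p, h1, h2, h3⟩ := ((eventually_ge_atTop p₀).and (e1.and e2)).exists
    exact ⟨p, h1, h2, h3⟩
  set D := (Finset.range p).powerset ×ˢ (Finset.range p).powerset with hD
  have hDcard : (D.card : ℝ) = 4 ^ p := by
    rw [hD, Finset.card_product, Finset.card_powerset, Finset.card_range, ← mul_pow]
    norm_num
  set g' : Finset ℕ × Finset ℕ → ℝ := fun t => g (t.1 ∩ Finset.range p₀, t.2 ∩ Finset.range p₀)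
    with hg'
  have hval : ∀ z, (if cellLabel p z ∈ D then g' (cellLabel p z) else 0) = g (cellLabel p₀ z) := by
    intro z
    rw [if_pos (by simp [hD, cellLabel, binDigits_subset])]
    simp only [hg', cellLabel, binDigits_inter_range hp]
  obtain ⟨N₁, d, bad, hN, hd, hdq, hbm, hbv, hdf, hdC⟩ :=
    exists_sum_bricks (p := p) (m := m) (g := g') (q := q) hδ (fun t => hg _) hpG (by linarith)
      hN₀ D (fun t ht => by simpa [hD] using ht)
  have hblock : ∀ z, partialSum d (block N₀ (N₁ + 1)) z = partialSum d (block N₀ N₁) z :=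
    partialSum_eq_of_subset (fun i hi => mem_block.mpr (by have := mem_block.mp hi; omega)) hd
  refine ⟨N₁ + 1, d, bad, by omega, fun i hi => hd i fun hc => hi (mem_block.mpr
    (by have := mem_block.mp hc; omega)), ?_, hbm, ?_, fun z hz => ?_, fun C hC => ?_⟩
  · rw [hDcard] at hdq
    refine le_trans (le_of_eq ?_) (hdq.trans hpq)
    symm
    refine Finset.sum_subset (fun i hi => mem_block.mpr (by have := mem_block.mp hi; omega))
      fun i _ hi => ?_
    rw [hd i hi, abs_zero, Real.zero_rpow (by linarith)]
  · refine hbv.trans ?_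
    rw [← ENNReal.ofReal_natCast, ← ENNReal.ofReal_mul (by positivity), hDcard]
    refine ENNReal.ofReal_le_ofReal (le_trans (le_of_eq ?_) hm.le)
    rw [one_div, inv_pow]
    field_simp
  · rw [hblock, hdf z hz, hval]
  · obtain ⟨r, hrm, hr, hrC⟩ := hdC C hC
    exact ⟨r, hrm, hr, fun z hz => by simpa only [hval] using hrC z hz⟩

/-! ### Density of step functions -/

lemma floor_two_pow_succ_mul (k : ℕ) (x : ℝ) :
    ⌊2 ^ (k + 1) * x⌋ = 2 * ⌊2 ^ k * x⌋ + if rademacher k x = -1 then 1 else 0 := by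
  have h0 := Int.fract_nonneg (2 ^ k * x)
  have h1 := Int.fract_lt_one (2 ^ k * x)
  have hx := Int.floor_add_fract (2 ^ k * x)
  have h2 : (2 : ℝ) ^ (k + 1) * x = 2 * (2 ^ k * x) := by ring
  rw [Int.floor_eq_iff, h2]
  unfold rademacher rademacherZero
  by_cases h : Int.fract (2 ^ k * x) < 1 / 2
  · rw [if_pos h, if_neg (by norm_num)]
    push_cast
    constructor <;> linarith
  · rw [if_neg h, if_pos rfl]
    push_cast
    constructor <;> linarith

lemma floor_eq_of_binDigits_eq {x y : ℝ} (hx : x ∈ Set.Ico (0 : ℝ) 1)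
    (hy : y ∈ Set.Ico (0 : ℝ) 1) {p : ℕ} (h : binDigits p x = binDigits p y) :
    ⌊2 ^ p * x⌋ = ⌊2 ^ p * y⌋ := by
  induction p with
  | zero =>
    rw [pow_zero, one_mul, one_mul, Int.floor_eq_zero_iff.mpr hx, Int.floor_eq_zero_iff.mpr hy]
  | succ p ih =>
    have h1 : binDigits p x = binDigits p y := by
      rw [← binDigits_inter_range p.le_succ, h, binDigits_inter_range p.le_succ]
    have h2 : rademacher p x = -1 ↔ rademacher p y = -1 := by
      have := congrArg (p ∈ ·) h
      simpa [binDigits] using this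
    rw [floor_two_pow_succ_mul, floor_two_pow_succ_mul, ih h1]
    simp only [h2]

lemma dist_lt_of_binDigits_eq {x y : ℝ} (hx : x ∈ Set.Ico (0 : ℝ) 1)
    (hy : y ∈ Set.Ico (0 : ℝ) 1) {p : ℕ} (h : binDigits p x = binDigits p y) :
    dist x y < (1 / 2) ^ p := by
  have := Int.abs_sub_lt_one_of_floor_eq_floor (floor_eq_of_binDigits_eq hx hy h)
  rw [← mul_sub, abs_mul, abs_of_pos (by positivity)] at this
  rw [Real.dist_eq, one_div, inv_pow, ← one_div, lt_div_iff₀ (by positivity), mul_comm]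
  exact this

lemma ae_mem_Ico : ∀ᵐ z ∂(volume.restrict T : Measure (ℝ × ℝ)),
    z.1 ∈ Set.Ico (0 : ℝ) 1 ∧ z.2 ∈ Set.Ico (0 : ℝ) 1 := by
  have h : T =ᵐ[(volume : Measure (ℝ × ℝ))] Set.Ico (0 : ℝ) 1 ×ˢ Set.Ico (0 : ℝ) 1 := by
    rw [Measure.volume_eq_prod]
    exact Measure.set_prod_ae_eq Ico_ae_eq_Icc.symm Ico_ae_eq_Icc.symm
  rw [Measure.restrict_congr_set h]
  exact ae_restrict_mem (measurableSet_Ico.prod measurableSet_Ico)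

/-- A weight that is measurable and takes its values in `(0, 1]`, everywhere on the plane. -/
structure IsWeight (μ : ℝ × ℝ → ℝ) : Prop where
  measurable : Measurable μ
  pos : ∀ z, 0 < μ z
  le_one : ∀ z, μ z ≤ 1

lemma lintegral_enorm_withDensity {μ : ℝ × ℝ → ℝ} (hμ : IsWeight μ) (h : ℝ × ℝ → ℝ) :
    ∫⁻ z, ‖h z‖ₑ ∂((volume.restrict T).withDensity fun z => ENNReal.ofReal (μ z)) =
      weightedNorm μ h := by
  rw [lintegral_withDensity_eq_lintegral_mul_non_measurable _ hμ.measurable.ennreal_ofReal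
    (Eventually.of_forall fun _ => ENNReal.ofReal_lt_top), weightedNorm]
  refine lintegral_congr fun z => ?_
  rw [Pi.mul_apply, mul_comm, ENNReal.ofReal_mul (abs_nonneg _), Real.enorm_eq_ofReal_abs]

lemma exists_continuous_approx {μ f : ℝ × ℝ → ℝ} (hμ : IsWeight μ) (hf : MemL1 μ f) {δ : ℝ}
    (hδ : 0 < δ) : ∃ φ : ℝ × ℝ → ℝ, UniformContinuous φ ∧
      weightedNorm μ (fun z => f z - φ z) ≤ ENNReal.ofReal δ := by
  set ν := (volume.restrict T).withDensity fun z => ENNReal.ofReal (μ z) with hν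
  have hint : Integrable μ (volume.restrict T) :=
    integrable_of_measurable_of_bound (M := 1) hμ.measurable fun z => by
      rw [abs_of_pos (hμ.pos z)]
      exact hμ.le_one z
  have : IsFiniteMeasure ν := isFiniteMeasure_withDensity_ofReal hint.2
  have hfν : Integrable f ν := by
    refine ⟨(hf.1.mono_ac (withDensity_absolutelyContinuous _ _)).aestronglyMeasurable, ?_⟩
    rw [hasFiniteIntegral_iff_enorm, lintegral_enorm_withDensity hμ]
    exact hf.2
  obtain ⟨φ, hφc, hφ, hcont, -⟩ := hfν.exists_hasCompactSupport_lintegral_sub_le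
    (ENNReal.ofReal_pos.mpr hδ).ne'
  exact ⟨φ, hφc.uniformContinuous_of_continuous hcont,
    (lintegral_enorm_withDensity hμ _).symm.le.trans hφ⟩

/-- The step functions on dyadic cells with finitely many nonzero rational values are dense in the
weighted space; they form a countable family. -/
theorem exists_rat_step_approx {μ f : ℝ × ℝ → ℝ} (hμ : IsWeight μ) (hf : MemL1 μ f) {δ : ℝ}
    (hδ : 0 < δ) : ∃ (p : ℕ) (g : (Finset ℕ × Finset ℕ) →₀ ℚ),
      weightedNorm μ (fun z => f z - (g (cellLabel p z) : ℝ)) ≤ ENNReal.ofReal δ := by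
  have hδ3 : 0 < δ / 3 := by positivity
  obtain ⟨φ, hφ, hfφ⟩ := exists_continuous_approx hμ hf hδ3
  obtain ⟨η, hη, hφη⟩ := Metric.uniformContinuous_iff.mp hφ (δ / 3) hδ3
  obtain ⟨p, hp⟩ : ∃ p : ℕ, ((1 / 2 : ℝ)) ^ p < η := exists_pow_lt_of_lt_one hη (by norm_num)
  have hrep : ∀ S : Finset ℕ, ∃ y : ℝ, (∃ x ∈ Set.Ico (0 : ℝ) 1, binDigits p x = S) →
      y ∈ Set.Ico (0 : ℝ) 1 ∧ binDigits p y = S := by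
    intro S
    by_cases h : ∃ x ∈ Set.Ico (0 : ℝ) 1, binDigits p x = S
    · obtain ⟨x, hx⟩ := h
      exact ⟨x, fun _ => hx⟩
    · exact ⟨0, fun h' => absurd h' h⟩
  choose rep hrep using hrep
  have hrat : ∀ t : Finset ℕ × Finset ℕ, ∃ q : ℚ, |φ (rep t.1, rep t.2) - q| < δ / 3 :=
    fun t => exists_rat_near _ hδ3
  choose q hq using hrat
  set D := (Finset.range p).powerset ×ˢ (Finset.range p).powerset with hD
  refine ⟨p, Finsupp.onFinset D (fun t => if t ∈ D then q t else 0) (fun t ht => by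
    by_contra h
    exact ht (if_neg h)), ?_⟩
  have hle : ∀ᵐ z ∂(volume.restrict T : Measure (ℝ × ℝ)),
      ENNReal.ofReal (|f z - ((if cellLabel p z ∈ D then q (cellLabel p z) else 0 : ℚ) : ℝ)| * μ z)
        ≤ ENNReal.ofReal (|f z - φ z| * μ z) + ENNReal.ofReal (2 * (δ / 3)) := by
    filter_upwards [ae_mem_Ico] with z hz
    rw [if_pos (by simp [hD, cellLabel, binDigits_subset]), ← ENNReal.ofReal_add
      (mul_nonneg (abs_nonneg _) (hμ.pos z).le) (by positivity)]
    refine ENNReal.ofReal_le_ofReal ?_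
    have h1 := hrep _ ⟨z.1, hz.1, rfl⟩
    have h2 := hrep _ ⟨z.2, hz.2, rfl⟩
    have h3 : dist z (rep (binDigits p z.1), rep (binDigits p z.2)) < η := by
      rw [Prod.dist_eq]
      exact max_lt ((dist_lt_of_binDigits_eq hz.1 h1.1 h1.2.symm).trans hp)
        ((dist_lt_of_binDigits_eq hz.2 h2.1 h2.2.symm).trans hp)
    have h4 := hφη h3
    rw [Real.dist_eq] at h4
    have h5 := hq (cellLabel p z)
    have h6 : |f z - q (cellLabel p z)| ≤ |f z - φ z| + 2 * (δ / 3) := by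
      calc |f z - q (cellLabel p z)|
          ≤ |f z - φ z| + |φ z - q (cellLabel p z)| := abs_sub_le _ _ _
        _ ≤ |f z - φ z| + (|φ z - φ (rep (binDigits p z.1), rep (binDigits p z.2))| +
            |φ (rep (binDigits p z.1), rep (binDigits p z.2)) - q (cellLabel p z)|) := by
            gcongr
            exact abs_sub_le _ _ _
        _ ≤ |f z - φ z| + 2 * (δ / 3) := by
            have : |φ (rep (binDigits p z.1), rep (binDigits p z.2)) - q (cellLabel p z)| < δ / 3 :=
              h5
            linarith
    nlinarith [hμ.pos z, hμ.le_one z, abs_nonneg (f z - φ z)]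
  calc weightedNorm μ _
      ≤ ∫⁻ z in T, (ENNReal.ofReal (|f z - φ z| * μ z) + ENNReal.ofReal (2 * (δ / 3))) :=
        lintegral_mono_ae (by simpa only [Finsupp.onFinset_apply] using hle)
    _ = weightedNorm μ (fun z => f z - φ z) + ENNReal.ofReal (2 * (δ / 3)) := by
        rw [lintegral_add_right _ measurable_const, weightedNorm]
        simp
    _ ≤ ENNReal.ofReal (δ / 3) + ENNReal.ofReal (2 * (δ / 3)) := by gcongr
    _ = ENNReal.ofReal δ := by
        rw [← ENNReal.ofReal_add (by positivity) (by positivity)]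
        congr 1
        ring

/-! ### The coefficients of the universal series -/

/-- Step functions `step s` together with Walsh polynomials of coefficients `d s` that correct them
outside of `bad s`, with spectra in successive square blocks `[N s, N (s + 1))²`. -/
structure BlockSystem where
  /-- The step functions to be corrected. -/
  step : ℕ → ℝ × ℝ → ℝ
  /-- A bound for each step function. -/
  bound : ℕ → ℝ
  /-- The ends of the blocks of the spectrum. -/
  N : ℕ → ℕ
  /-- The coefficients of the correcting polynomials. -/
  d : ℕ → ℕ × ℕ → ℝ
  /-- The exceptional sets. -/
  bad : ℕ → Set (ℝ × ℝ)
  measurable_step : ∀ s, Measurable (step s)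
  abs_step_le : ∀ s z, |step s z| ≤ bound s
  strictMono : StrictMono N
  one_le : ∀ s, 1 ≤ N s
  coeff_eq_zero : ∀ s, ∀ i ∉ block (N s) (N (s + 1)), d s i = 0
  sum_rpow_le : ∀ s,
    ∑ i ∈ block (N s) (N (s + 1)), |d s i| ^ (2 + 1 / ((s : ℝ) + 1)) ≤ (1 / 2) ^ s
  measurableSet_bad : ∀ s, MeasurableSet (bad s)
  measure_bad_le : ∀ s, volume.restrict T (bad s) ≤ ENNReal.ofReal ((1 / 2) ^ s)
  partialSum_eq : ∀ s, ∀ z ∉ bad s, partialSum (d s) (block (N s) (N (s + 1))) z = step s z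
  truncation : ∀ s C, IsLowerIndexSet C → ∃ r : ℝ × ℝ → ℝ, Measurable r ∧
    ∫⁻ z in T, ENNReal.ofReal |r z| ≤ ENNReal.ofReal ((1 / 2) ^ s) ∧
    ∀ z ∉ bad s, |partialSum (d s) C z| ≤ |step s z| + |r z|

lemma measurable_cellLabel_comp (p : ℕ) (g : Finset ℕ × Finset ℕ → ℝ) :
    Measurable fun z => g (cellLabel p z) := by
  classical
  set D := (Finset.range p).powerset ×ˢ (Finset.range p).powerset with hD
  have h : (fun z => g (cellLabel p z)) = fun z : ℝ × ℝ => ∑ t ∈ D, g t / 4 ^ p *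
      ((∏ k ∈ Finset.range p, (1 + signAt t.1 k * rademacher k z.1)) *
        ∏ k ∈ Finset.range p, (1 + signAt t.2 k * rademacher k z.2)) := by
    funext z
    have hz : cellLabel p z ∈ D := by simp [hD, cellLabel, binDigits_subset]
    have h4 : (4 : ℝ) ^ p = 2 ^ p * 2 ^ p := by rw [← mul_pow]; norm_num
    rw [Finset.sum_eq_single (cellLabel p z)]
    · rw [cellLabel, prod_one_add_signAt (binDigits_subset p z.1),
        prod_one_add_signAt (binDigits_subset p z.2), if_pos rfl, if_pos rfl, ← h4]
      field_simp
    · intro t ht hne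
      simp only [hD, Finset.mem_product, Finset.mem_powerset] at ht
      rw [prod_one_add_signAt ht.1, prod_one_add_signAt ht.2]
      by_cases h1 : binDigits p z.1 = t.1
      · rw [if_neg (c := binDigits p z.2 = t.2) fun h2 => hne (by rw [cellLabel, h1, h2])]
        simp
      · simp [h1]
    · exact fun hc => absurd hz hc
  rw [h]
  fun_prop

/-- There is a block system in which the step functions approximate everything in every weighted
space, infinitely often. -/
theorem exists_blockSystem : ∃ B : BlockSystem, ∀ μ f : ℝ × ℝ → ℝ, IsWeight μ → MemL1 μ f →
    ∀ (δ : ℝ) (n : ℕ), 0 < δ →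
      ∃ s ≥ n, weightedNorm μ (fun z => f z - B.step s z) ≤ ENNReal.ofReal δ := by
  obtain ⟨e, he⟩ := exists_surjective_nat (ℕ × ((Finset ℕ × Finset ℕ) →₀ ℚ))
  -- Unpairing the index makes each pair of a level and of values occur infinitely often.
  set P : ℕ → ℕ := fun s => (e s.unpair.2).1 with hP
  set g : ℕ → Finset ℕ × Finset ℕ → ℝ := fun s t => ((e s.unpair.2).2 t : ℝ) with hg
  set G : ℕ → ℝ := fun s => ∑ t ∈ (e s.unpair.2).2.support, |g s t| with hG
  have hgG : ∀ s t, |g s t| ≤ G s := by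
    intro s t
    by_cases ht : t ∈ (e s.unpair.2).2.support
    · exact Finset.single_le_sum (f := fun t => |g s t|) (fun _ _ => abs_nonneg _) ht
    · have : g s t = 0 := by simp [hg, Finsupp.notMem_support_iff.mp ht]
      rw [this, abs_zero]
      exact Finset.sum_nonneg fun _ _ => abs_nonneg _
  have hq : ∀ s : ℕ, (2 : ℝ) < 2 + 1 / ((s : ℝ) + 1) := fun s => by
    have : (0 : ℝ) < 1 / ((s : ℝ) + 1) := by positivity
    linarith
  have hcor := fun (s : ℕ) (N₀ : {n : ℕ // 1 ≤ n}) =>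
    exists_correction (P s) (hgG s) (show (0 : ℝ) < (1 / 2) ^ s by positivity) (hq s) N₀.2
  choose N₁ d bad hN hd hdq hbm hbv hdf hdC using hcor
  set N : ℕ → {n : ℕ // 1 ≤ n} := fun s =>
    Nat.rec ⟨1, le_rfl⟩ (fun s n => ⟨N₁ s n, n.2.trans (hN s n).le⟩) s
  refine ⟨{ step := fun s z => g s (cellLabel (P s) z)
            bound := G
            N := fun s => N s
            d := fun s => d s (N s)
            bad := fun s => bad s (N s)
            measurable_step := fun s => measurable_cellLabel_comp (P s) (g s)
            abs_step_le := fun s z => hgG s _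
            strictMono := strictMono_nat_of_lt_succ fun s => hN s (N s)
            one_le := fun s => (N s).2
            coeff_eq_zero := fun s => hd s (N s)
            sum_rpow_le := fun s => hdq s (N s)
            measurableSet_bad := fun s => hbm s (N s)
            measure_bad_le := fun s => hbv s (N s)
            partialSum_eq := fun s => hdf s (N s)
            truncation := fun s => hdC s (N s) }, ?_⟩
  intro μ f hμ hf δ n hδ
  obtain ⟨p, h, hph⟩ := exists_rat_step_approx hμ hf hδ
  obtain ⟨j, hj⟩ := he (p, h)
  refine ⟨Nat.pair n j, Nat.left_le_pair n j, ?_⟩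
  simpa [hg, hP, hj] using hph

namespace BlockSystem

variable (B : BlockSystem)

/-- The index block that carries the spectrum of the correcting polynomial with number `s`. -/
def blk (s : ℕ) : Finset (ℕ × ℕ) := block (B.N s) (B.N (s + 1))

/-- The correcting polynomial with number `s`. -/
noncomputable def poly (s : ℕ) : ℝ × ℝ → ℝ := partialSum (B.d s) (B.blk s)

/-- The coefficients of the series that consists of all correcting polynomials. Since
`s ≤ B.N s`, only the polynomials with number at most `i.1` can have the index `i`. -/
noncomputable def coeff (i : ℕ × ℕ) : ℝ := ∑ s ∈ Finset.range (i.1 + 1), B.d s i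

variable {B}

lemma le_fst_of_mem_blk {s : ℕ} {i : ℕ × ℕ} (h : i ∈ B.blk s) : s ≤ i.1 :=
  B.strictMono.le_apply.trans (mem_block.mp h).1.1

lemma eq_of_mem_blk {s s' : ℕ} {i : ℕ × ℕ} (h : i ∈ B.blk s) (h' : i ∈ B.blk s') : s = s' := by
  have h1 := mem_block.mp h
  have h2 := mem_block.mp h'
  rcases lt_trichotomy s s' with hlt | heq | hlt
  · have := B.strictMono.monotone (show s + 1 ≤ s' from hlt)
    omega
  · exact heq
  · have := B.strictMono.monotone (show s' + 1 ≤ s from hlt)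
    omega

lemma d_eq_zero {s : ℕ} {i : ℕ × ℕ} (h : i ∉ B.blk s) : B.d s i = 0 := B.coeff_eq_zero s i h

lemma coeff_of_mem {s : ℕ} {i : ℕ × ℕ} (h : i ∈ B.blk s) : B.coeff i = B.d s i :=
  Finset.sum_eq_single s (fun _ _ hne => d_eq_zero fun h' => hne (eq_of_mem_blk h' h))
    fun hs => absurd (Finset.mem_range.mpr (Nat.lt_succ_of_le (le_fst_of_mem_blk h))) hs

lemma coeff_of_forall_notMem {i : ℕ × ℕ} (h : ∀ s, i ∉ B.blk s) : B.coeff i = 0 :=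
  Finset.sum_eq_zero fun s _ => d_eq_zero (h s)

/-- The exponents `2 + 1 / (s + 1)` decrease to `2`, and eventually the coefficients are at most
`1`, so the geometric bound carries over to every exponent above `2`. -/
lemma summable_sum_rpow (B : BlockSystem) {q : ℝ} (hq : 2 < q) :
    Summable fun s => ∑ i ∈ B.blk s, |B.d s i| ^ q := by
  have hev : ∀ᶠ s : ℕ in atTop, 1 / ((s : ℝ) + 1) < q - 2 :=
    (tendsto_one_div_add_atTop_nhds_zero_nat (𝕜 := ℝ)).eventually_lt_const (by linarith)
  refine summable_of_isBigO_nat (summable_geometric_of_lt_one (r := 1 / 2) (by norm_num)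
    (by norm_num)) (Asymptotics.IsBigO.of_bound 1 ?_)
  filter_upwards [hev] with s hs
  have hs0 : (0 : ℝ) ≤ 1 / ((s : ℝ) + 1) := by positivity
  rw [Real.norm_of_nonneg (Finset.sum_nonneg fun _ _ => by positivity),
    Real.norm_of_nonneg (by positivity), one_mul]
  refine le_trans (Finset.sum_le_sum fun i hi => ?_) (B.sum_rpow_le s)
  have hle : |B.d s i| ^ (2 + 1 / ((s : ℝ) + 1)) ≤ 1 :=
    (Finset.single_le_sum (f := fun i => |B.d s i| ^ (2 + 1 / ((s : ℝ) + 1)))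
      (fun _ _ => by positivity) hi).trans
      ((B.sum_rpow_le s).trans (pow_le_one₀ (by norm_num) (by norm_num)))
  have h1 : |B.d s i| ≤ 1 := by
    by_contra hc
    exact absurd hle (not_le.mpr (Real.one_lt_rpow (not_le.mp hc) (by linarith)))
  exact Real.rpow_le_rpow_of_exponent_ge_of_imp (abs_nonneg _) h1 (by linarith)
    fun _ hc => absurd hc (by linarith)

lemma summable_coeff_rpow (B : BlockSystem) {q : ℝ} (hq : 2 < q) :
    Summable fun i => |B.coeff i| ^ q := by
  refine summable_of_sum_le (c := ∑' s, ∑ i ∈ B.blk s, |B.d s i| ^ q)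
    (fun i => by positivity) fun u => ?_
  have h0 : (0 : ℝ) ^ q = 0 := Real.zero_rpow (by linarith)
  have h1 : ∀ i ∈ u, |B.coeff i| ^ q ≤
      ∑ s ∈ Finset.range (u.sup Prod.fst + 1), |B.d s i| ^ q := by
    intro i hi
    by_cases h : ∃ s, i ∈ B.blk s
    · obtain ⟨s, hs⟩ := h
      rw [coeff_of_mem hs]
      refine Finset.single_le_sum (f := fun s => |B.d s i| ^ q) (fun _ _ => by positivity)
        (Finset.mem_range.mpr (Nat.lt_succ_of_le ?_))
      exact (le_fst_of_mem_blk hs).trans (Finset.le_sup (f := Prod.fst) hi)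
    · rw [coeff_of_forall_notMem (not_exists.mp h), abs_zero, h0]
      exact Finset.sum_nonneg fun _ _ => by positivity
  calc ∑ i ∈ u, |B.coeff i| ^ q
      ≤ ∑ i ∈ u, ∑ s ∈ Finset.range (u.sup Prod.fst + 1), |B.d s i| ^ q := Finset.sum_le_sum h1
    _ = ∑ s ∈ Finset.range (u.sup Prod.fst + 1), ∑ i ∈ u, |B.d s i| ^ q := Finset.sum_comm
    _ ≤ ∑ s ∈ Finset.range (u.sup Prod.fst + 1), ∑ i ∈ B.blk s, |B.d s i| ^ q := by
        refine Finset.sum_le_sum fun s _ => ?_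
        have : ∑ i ∈ u ∩ B.blk s, |B.d s i| ^ q = ∑ i ∈ u, |B.d s i| ^ q := by
          refine Finset.sum_subset Finset.inter_subset_left fun i hi hi' => ?_
          rw [d_eq_zero fun hc => hi' (Finset.mem_inter.mpr ⟨hi, hc⟩), abs_zero, h0]
        rw [← this]
        exact Finset.sum_le_sum_of_subset_of_nonneg Finset.inter_subset_right
          fun _ _ _ => by positivity
    _ ≤ _ := (B.summable_sum_rpow hq).sum_le_tsum _ fun _ _ =>
        Finset.sum_nonneg fun _ _ => by positivity

/-! ### The weight -/

/-- A bound for the step function with number `s` plus any truncation of its correction. -/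
noncomputable def sup (B : BlockSystem) (s : ℕ) : ℝ := B.bound s + ∑ i ∈ B.blk s, |B.d s i|

lemma bound_nonneg (B : BlockSystem) (s : ℕ) : 0 ≤ B.bound s :=
  (abs_nonneg _).trans (B.abs_step_le s (0, 0))

lemma sup_nonneg (B : BlockSystem) (s : ℕ) : 0 ≤ B.sup s :=
  add_nonneg (B.bound_nonneg s) (Finset.sum_nonneg fun _ _ => abs_nonneg _)

lemma abs_step_add_abs_partialSum_le (B : BlockSystem) (s : ℕ) (C : Finset (ℕ × ℕ)) (z : ℝ × ℝ) :
    |B.step s z| + |partialSum (B.d s) C z| ≤ B.sup s := by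
  refine add_le_add (B.abs_step_le s z) ((abs_partialSum_le _ _ _).trans ?_)
  have : ∑ i ∈ C ∩ B.blk s, |B.d s i| = ∑ i ∈ C, |B.d s i| := by
    refine Finset.sum_subset Finset.inter_subset_left fun i hi hi' => ?_
    rw [d_eq_zero fun hc => hi' (Finset.mem_inter.mpr ⟨hi, hc⟩), abs_zero]
  rw [← this]
  exact Finset.sum_le_sum_of_subset_of_nonneg Finset.inter_subset_right
    fun _ _ _ => abs_nonneg _

/-- A weight equal to `1` off a small set and so small on the exceptional sets, from some number
on, that all truncations are negligible there. Almost every point lies in finitely many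
exceptional sets only, so the infimum of the conditions on the weight is positive. -/
theorem exists_weight (B : BlockSystem) {ε : ℝ} (hε : 0 < ε) :
    ∃ (μ : ℝ × ℝ → ℝ) (s₀ : ℕ), IsWeight μ ∧
      volume {z ∈ T | μ z ≠ 1} < ENNReal.ofReal ε ∧
      ∀ s ≥ s₀, ∀ᵐ z ∂(volume.restrict T : Measure (ℝ × ℝ)),
        z ∈ B.bad s → B.sup s * μ z ≤ (1 / 2) ^ s := by
  classical
  set h : ℕ → ℝ := fun s => (2 ^ s * (1 + ∑ t ∈ Finset.range (s + 1), B.sup t))⁻¹ with hh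
  have hone : ∀ s, 1 ≤ 1 + ∑ t ∈ Finset.range (s + 1), B.sup t := fun s =>
    le_add_of_nonneg_right (Finset.sum_nonneg fun t _ => B.sup_nonneg t)
  have hpos : ∀ s, 0 < h s := fun s =>
    inv_pos.mpr (mul_pos (by positivity) (zero_lt_one.trans_le (hone s)))
  have hanti : Antitone h := by
    intro s t hst
    refine inv_anti₀ (mul_pos (by positivity) (zero_lt_one.trans_le (hone s))) ?_
    have h1 : ∑ t ∈ Finset.range (s + 1), B.sup t ≤ ∑ t ∈ Finset.range (t + 1), B.sup t :=
      Finset.sum_le_sum_of_subset_of_nonneg (Finset.range_subset_range.mpr (by omega))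
        fun i _ _ => B.sup_nonneg i
    have h2 := zero_le_one.trans (hone s)
    have h3 : (2 : ℝ) ^ s ≤ 2 ^ t := pow_le_pow_right₀ (by norm_num) hst
    gcongr
  have hsup : ∀ s, B.sup s * h s ≤ (1 / 2) ^ s := by
    intro s
    have h1 := zero_lt_one.trans_le (hone s)
    simp only [hh]
    rw [← div_eq_mul_inv, div_le_iff₀ (by positivity)]
    have h2 : B.sup s ≤ ∑ t ∈ Finset.range (s + 1), B.sup t :=
      Finset.single_le_sum (f := B.sup) (fun t _ => B.sup_nonneg t) (Finset.self_mem_range_succ s)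
    rw [← mul_assoc, ← mul_pow]
    norm_num
    linarith
  have hle1 : ∀ s, h s ≤ 1 := fun s =>
    inv_le_one_of_one_le₀ (one_le_mul_of_one_le_of_one_le (one_le_pow₀ (by norm_num)) (hone s))
  obtain ⟨s₀, hs₀⟩ : ∃ s₀ : ℕ, ((1 / 2 : ℝ)) ^ s₀ < ε / 2 :=
    exists_pow_lt_of_lt_one (by positivity) (by norm_num)
  set w : ℕ → ℝ × ℝ → ℝ := fun s z => if s₀ ≤ s ∧ z ∈ B.bad s then h s else 1 with hw
  have hwm : ∀ s, Measurable (w s) := fun s =>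
    Measurable.ite ((MeasurableSet.const _).inter (B.measurableSet_bad s)) measurable_const
      measurable_const
  have hwpos : ∀ s z, 0 < w s z := fun s z => by
    simp only [hw]
    split_ifs
    exacts [hpos s, one_pos]
  have hwle : ∀ s z, w s z ≤ 1 := fun s z => by
    simp only [hw]
    split_ifs
    exacts [hle1 s, le_rfl]
  have hbdd : ∀ z, BddBelow (Set.range fun s => w s z) := fun z =>
    ⟨0, by rintro _ ⟨s, rfl⟩; exact (hwpos s z).le⟩
  set u : ℝ × ℝ → ℝ := fun z => ⨅ s, w s z with hu
  have hum : Measurable u := Measurable.iInf hwm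
  have hsum : ∑' s, volume.restrict T (B.bad s) ≠ ⊤ := by
    refine ((ENNReal.tsum_le_tsum B.measure_bad_le).trans_lt ?_).ne
    rw [← ENNReal.ofReal_tsum_of_nonneg (fun s => by positivity)
      (summable_geometric_of_lt_one (by norm_num) (by norm_num))]
    exact ENNReal.ofReal_lt_top
  have hupos : ∀ᵐ z ∂(volume.restrict T : Measure (ℝ × ℝ)), 0 < u z := by
    filter_upwards [ae_eventually_notMem hsum] with z hz
    obtain ⟨n, hn⟩ := eventually_atTop.mp hz
    refine (hpos n).trans_le (le_ciInf fun s => ?_)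
    simp only [hw]
    split_ifs with hs
    · refine hanti ?_
      by_contra hc
      exact hn s (by omega) hs.2
    · exact hle1 n
  -- The value on the null set where the infimum vanishes is immaterial.
  set μ : ℝ × ℝ → ℝ := fun z => if 0 < u z then u z else 1 with hμ
  refine ⟨μ, s₀, ⟨Measurable.ite (measurableSet_lt measurable_const hum) hum measurable_const,
    fun z => ?_, fun z => ?_⟩, ?_, fun s hs => ?_⟩
  · simp only [hμ]
    split_ifs with h
    exacts [h, one_pos]
  · simp only [hμ]
    split_ifs
    exacts [(ciInf_le (hbdd z) 0).trans (hwle 0 z), le_rfl]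
  · have hsub : {z ∈ T | μ z ≠ 1} ⊆ (⋃ s, B.bad (s₀ + s)) ∩ T := by
      rintro z ⟨hzT, hz⟩
      refine ⟨?_, hzT⟩
      by_contra hc
      simp only [Set.mem_iUnion, not_exists] at hc
      refine hz ?_
      have : u z = 1 := by
        have h1 : ∀ s, w s z = 1 := fun s => if_neg fun hs => by
          obtain ⟨k, rfl⟩ := Nat.exists_eq_add_of_le hs.1
          exact hc k hs.2
        simp only [hu, h1, ciInf_const]
      simp [hμ, this]
    calc volume {z ∈ T | μ z ≠ 1} ≤ volume ((⋃ s, B.bad (s₀ + s)) ∩ T) := measure_mono hsub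
      _ = volume.restrict T (⋃ s, B.bad (s₀ + s)) :=
          (Measure.restrict_apply (MeasurableSet.iUnion fun s => B.measurableSet_bad _)).symm
      _ ≤ ∑' s, ENNReal.ofReal ((1 / 2) ^ s₀ * (1 / 2) ^ s) := by
          refine (measure_iUnion_le _).trans (ENNReal.tsum_le_tsum fun s => ?_)
          rw [← pow_add]
          exact B.measure_bad_le _
      _ = ENNReal.ofReal ((1 / 2) ^ s₀ * 2) := by
          rw [← ENNReal.ofReal_tsum_of_nonneg (fun s => by positivity)
            ((summable_geometric_of_lt_one (by norm_num) (by norm_num)).mul_left _),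
            tsum_mul_left, tsum_geometric_two]
      _ < ENNReal.ofReal ε := (ENNReal.ofReal_lt_ofReal_iff hε).mpr (by linarith)
  · filter_upwards [hupos] with z hz hzs
    have h1 : u z ≤ h s := (ciInf_le (hbdd z) s).trans_eq (if_pos ⟨hs, hzs⟩)
    have h2 : μ z = u z := if_pos hz
    rw [h2]
    exact (mul_le_mul_of_nonneg_left h1 (B.sup_nonneg s)).trans (hsup s)

end BlockSystem

/-! ### Weighted estimates -/

lemma weightedNorm_add_le {μ f g : ℝ × ℝ → ℝ} (hμ : IsWeight μ)
    (hg : AEMeasurable g (volume.restrict T)) :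
    weightedNorm μ (fun z => f z + g z) ≤ weightedNorm μ f + weightedNorm μ g := by
  have hm : AEMeasurable (fun z => ENNReal.ofReal (|g z| * μ z)) (volume.restrict T) :=
    (hg.abs.mul hμ.measurable.aemeasurable).ennreal_ofReal
  rw [weightedNorm, weightedNorm, weightedNorm, ← lintegral_add_right' _ hm]
  refine lintegral_mono fun z => ?_
  have h0 := (hμ.pos z).le
  dsimp only
  rw [← ENNReal.ofReal_add (by positivity) (by positivity), ← add_mul]
  exact ENNReal.ofReal_le_ofReal (mul_le_mul_of_nonneg_right (abs_add_le _ _) h0)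

lemma weightedNorm_neg (μ f : ℝ × ℝ → ℝ) :
    weightedNorm μ (fun z => -f z) = weightedNorm μ f := by
  simp [weightedNorm]

lemma MemL1.sub_of_bound {μ f g : ℝ × ℝ → ℝ} (hμ : IsWeight μ) (hf : MemL1 μ f)
    (hg : Measurable g) {M : ℝ} (hM : ∀ z, |g z| ≤ M) : MemL1 μ (fun z => f z - g z) := by
  refine ⟨hf.1.sub hg.aemeasurable, ?_⟩
  have h1 : weightedNorm μ (fun z => -g z) ≤ ENNReal.ofReal M := by
    rw [weightedNorm_neg]
    calc weightedNorm μ g ≤ ∫⁻ _ in T, ENNReal.ofReal M := by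
          refine lintegral_mono fun z => ENNReal.ofReal_le_ofReal ?_
          exact (mul_le_of_le_one_right (abs_nonneg _) (hμ.le_one z)).trans (hM z)
      _ = ENNReal.ofReal M := by simp
  simp only [sub_eq_add_neg]
  exact (weightedNorm_add_le hμ hg.neg.aemeasurable).trans_lt
    (ENNReal.add_lt_top.mpr ⟨hf.2, h1.trans_lt ENNReal.ofReal_lt_top⟩)

namespace BlockSystem

variable {B : BlockSystem} {μ : ℝ × ℝ → ℝ}

lemma measurable_poly (B : BlockSystem) (s : ℕ) : Measurable (B.poly s) :=
  measurable_partialSum _ _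

lemma weightedNorm_step_sub_poly_le (hμ : IsWeight μ) {s : ℕ}
    (hs : ∀ᵐ z ∂(volume.restrict T : Measure (ℝ × ℝ)), z ∈ B.bad s → B.sup s * μ z ≤ (1 / 2) ^ s) :
    weightedNorm μ (fun z => B.step s z - B.poly s z) ≤ ENNReal.ofReal ((1 / 2) ^ s) := by
  calc weightedNorm μ _ ≤ ∫⁻ _ in T, ENNReal.ofReal ((1 / 2) ^ s) := by
        refine lintegral_mono_ae ?_
        filter_upwards [hs] with z hz
        refine ENNReal.ofReal_le_ofReal ?_
        by_cases hb : z ∈ B.bad s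
        · refine le_trans (mul_le_mul_of_nonneg_right ?_ (hμ.pos z).le) (hz hb)
          exact (abs_sub _ _).trans (B.abs_step_add_abs_partialSum_le s _ z)
        · have : B.poly s z = B.step s z := B.partialSum_eq s z hb
          rw [this, sub_self, abs_zero, zero_mul]
          positivity
    _ = _ := by simp

lemma weightedNorm_truncation_le (hμ : IsWeight μ) {s : ℕ}
    (hs : ∀ᵐ z ∂(volume.restrict T : Measure (ℝ × ℝ)), z ∈ B.bad s → B.sup s * μ z ≤ (1 / 2) ^ s)
    {C : Finset (ℕ × ℕ)} (hC : IsLowerIndexSet C) :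
    weightedNorm μ (partialSum (B.d s) C) ≤
      weightedNorm μ (B.step s) + 2 * ENNReal.ofReal ((1 / 2) ^ s) := by
  obtain ⟨r, hrm, hr, hrC⟩ := B.truncation s C hC
  calc weightedNorm μ (partialSum (B.d s) C)
      ≤ ∫⁻ z in T, (ENNReal.ofReal (|B.step s z| * μ z) +
          (ENNReal.ofReal |r z| + ENNReal.ofReal ((1 / 2) ^ s))) := by
        refine lintegral_mono_ae ?_
        filter_upwards [hs] with z hz
        have h0 := (hμ.pos z).le
        have h1 := hμ.le_one z
        rw [← ENNReal.ofReal_add (abs_nonneg _) (by positivity),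
          ← ENNReal.ofReal_add (by positivity) (by positivity)]
        refine ENNReal.ofReal_le_ofReal ?_
        have h2 : (0 : ℝ) ≤ (1 / 2) ^ s := by positivity
        have h3 := abs_nonneg (r z)
        by_cases hb : z ∈ B.bad s
        · have h4 := B.abs_step_add_abs_partialSum_le s C z
          have h5 : |partialSum (B.d s) C z| * μ z ≤ B.sup s * μ z :=
            mul_le_mul_of_nonneg_right (by linarith [abs_nonneg (B.step s z)]) h0
          have h6 : 0 ≤ |B.step s z| * μ z := by positivity
          linarith [hz hb]
        · have h5 := mul_le_mul_of_nonneg_right (hrC z hb) h0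
          have h6 : |r z| * μ z ≤ |r z| := mul_le_of_le_one_right h3 h1
          linarith
    _ = weightedNorm μ (B.step s) +
          (∫⁻ z in T, ENNReal.ofReal |r z| + ENNReal.ofReal ((1 / 2) ^ s)) := by
        rw [lintegral_add_right _ (by fun_prop)]
        rfl
    _ ≤ _ := by
        rw [lintegral_add_right _ measurable_const, two_mul]
        gcongr
        simp

/-! ### Universality -/

/-- The indices of the subseries formed by the blocks with numbers `σ k`; whole blocks are taken,
including the indices with coefficient zero. -/
def subseries (B : BlockSystem) (σ : ℕ → ℕ) : Set (ℕ × ℕ) := {i | ∃ k, i ∈ B.blk (σ k)}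

lemma corner_mem_blk (B : BlockSystem) (s : ℕ) : (B.N s, B.N s) ∈ B.blk s := by
  have := B.strictMono (Nat.lt_succ_self s)
  exact mem_block.mpr ⟨⟨le_rfl, this⟩, le_rfl, this⟩

lemma subseries_infinite (B : BlockSystem) {σ : ℕ → ℕ} (hσ : StrictMono σ) :
    (B.subseries σ).Infinite := by
  refine Set.infinite_of_injective_forall_mem (f := fun k => (B.N (σ k), B.N (σ k)))
    (fun k l h => ?_) fun k => ⟨k, B.corner_mem_blk (σ k)⟩
  exact (B.strictMono.comp hσ).injective (congrArg Prod.fst h)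

lemma indicator_subseries_coeff {σ : ℕ → ℕ} (hσ : StrictMono σ) {i : ℕ × ℕ} {n : ℕ}
    (hi : i.1 < n) : (B.subseries σ).indicator B.coeff i =
      ∑ k ∈ Finset.range n, B.d (σ k) i := by
  by_cases h : i ∈ B.subseries σ
  · obtain ⟨k, hk⟩ := h
    rw [Set.indicator_of_mem (show i ∈ B.subseries σ from ⟨k, hk⟩), coeff_of_mem hk]
    refine (Finset.sum_eq_single k (fun l _ hne => d_eq_zero fun hl =>
      hne (hσ.injective (eq_of_mem_blk hl hk))) fun hn => absurd ?_ hn).symm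
    exact Finset.mem_range.mpr ((hσ.le_apply.trans (le_fst_of_mem_blk hk)).trans_lt hi)
  · rw [Set.indicator_of_notMem h]
    exact (Finset.sum_eq_zero fun k _ => d_eq_zero fun hk => h ⟨k, hk⟩).symm

/-- A truncation of the subseries consists of complete blocks and a truncation of the first block
that is not contained in it. -/
lemma exists_partialSum_subseries_eq {σ : ℕ → ℕ} (hσ : StrictMono σ) {C : Finset (ℕ × ℕ)}
    (hC : IsLowerIndexSet C) : ∃ κ, ¬B.blk (σ κ) ⊆ C ∧ ∀ z,
      partialSum ((B.subseries σ).indicator B.coeff) C z =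
        ∑ k ∈ Finset.range κ, B.poly (σ k) z + partialSum (B.d (σ κ)) C z := by
  classical
  have hCn : ∀ i ∈ C, i.1 < C.sup Prod.fst + 1 := fun i hi =>
    Nat.lt_succ_of_le (Finset.le_sup (f := Prod.fst) hi)
  have hex : ∃ k, ¬B.blk (σ k) ⊆ C := by
    refine ⟨C.sup Prod.fst + 1, fun h => ?_⟩
    have h1 := hCn _ (h (B.corner_mem_blk _))
    have h2 : C.sup Prod.fst + 1 ≤ B.N (σ (C.sup Prod.fst + 1)) :=
      (B.strictMono.comp hσ).le_apply
    simp only at h1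
    omega
  set κ := Nat.find hex with hκ
  refine ⟨κ, Nat.find_spec hex, fun z => ?_⟩
  have hlt : ∀ k < κ, B.blk (σ k) ⊆ C := fun k hk => not_not.mp (Nat.find_min hex hk)
  have hgt : ∀ k, κ < k → ∀ i ∈ C, i ∉ B.blk (σ k) := by
    intro k hk i hi hik
    rcases hC.cut (B.N (σ κ + 1)) with h | h
    · have h1 := mem_block.mp hik
      have h2 := B.strictMono.monotone (show σ κ + 1 ≤ σ k from hσ hk)
      exact h i hi (by omega) (by omega)
    · exact Nat.find_spec hex (h _ (B.one_le _))
  set n := C.sup Prod.fst + 1 + (κ + 1) with hn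
  have h1 : partialSum ((B.subseries σ).indicator B.coeff) C z =
      ∑ k ∈ Finset.range n, partialSum (B.d (σ k)) C z := by
    simp only [partialSum]
    rw [Finset.sum_comm]
    refine Finset.sum_congr rfl fun i hi => ?_
    rw [indicator_subseries_coeff hσ ((hCn i hi).trans_le (Nat.le_add_right _ (κ + 1))),
      Finset.sum_mul, Finset.sum_mul]
  have h2 : ∑ k ∈ Finset.range (κ + 1), partialSum (B.d (σ k)) C z =
      ∑ k ∈ Finset.range n, partialSum (B.d (σ k)) C z := by
    refine Finset.sum_subset (Finset.range_subset_range.mpr (by omega)) fun k _ hk => ?_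
    refine partialSum_eq_zero (fun i hi => d_eq_zero (hgt k ?_ i hi)) z
    rw [Finset.mem_range] at hk
    omega
  rw [h1, ← h2, Finset.sum_range_succ]
  congr 1
  refine Finset.sum_congr rfl fun k hk => ?_
  exact partialSum_eq_of_subset (hlt k (Finset.mem_range.mp hk)) (B.coeff_eq_zero (σ k)) z

/-- Greedy choice of the blocks: the next step function approximates what the previous corrected
step functions leave of `f`. -/
lemma exists_greedy (hμ : IsWeight μ)
    (hdense : ∀ f, MemL1 μ f → ∀ (δ : ℝ) (n : ℕ), 0 < δ →
      ∃ s ≥ n, weightedNorm μ (fun z => f z - B.step s z) ≤ ENNReal.ofReal δ)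
    {f : ℝ × ℝ → ℝ} (hf : MemL1 μ f) (s₀ : ℕ) :
    ∃ σ : ℕ → ℕ, StrictMono σ ∧ (∀ k, s₀ ≤ σ k) ∧ ∀ k,
      weightedNorm μ (fun z => f z - ∑ l ∈ Finset.range k, B.poly (σ l) z - B.step (σ k) z) ≤
        ENNReal.ofReal ((1 / 2) ^ k) := by
  have hpick : ∀ (x : {x : (ℝ × ℝ → ℝ) × ℕ // MemL1 μ x.1}) (k : ℕ), ∃ s ≥ x.1.2,
      weightedNorm μ (fun z => x.1.1 z - B.step s z) ≤ ENNReal.ofReal ((1 / 2) ^ k) :=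
    fun x k => hdense x.1.1 x.2 _ _ (by positivity)
  choose pick hpick1 hpick2 using hpick
  set st : ℕ → {x : (ℝ × ℝ → ℝ) × ℕ // MemL1 μ x.1} := fun k =>
    Nat.rec ⟨(f, s₀), hf⟩ (fun k x => ⟨(fun z => x.1.1 z - B.poly (pick x k) z, pick x k + 1),
      x.2.sub_of_bound hμ (B.measurable_poly _) (abs_partialSum_le _ _)⟩) k
  have hst : ∀ k z, (st k).1.1 z = f z - ∑ l ∈ Finset.range k, B.poly (pick (st l) l) z := by
    intro k z
    induction k with
    | zero => simp [st]
    | succ k ih =>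
      rw [Finset.sum_range_succ, ← sub_sub, ← ih]
  have hmono : StrictMono fun k => pick (st k) k :=
    strictMono_nat_of_lt_succ fun k => hpick1 (st (k + 1)) (k + 1)
  refine ⟨fun k => pick (st k) k, hmono, fun k => ?_, fun k => ?_⟩
  · exact (hpick1 (st 0) 0).trans (hmono.monotone (Nat.zero_le k))
  · simpa only [hst] using hpick2 (st k) k

/-- Along a greedy choice, the truncations of the subseries converge to `f`. -/
lemma weightedNorm_partialSum_sub_le (hμ : IsWeight μ) {s₀ : ℕ}
    (hs : ∀ s ≥ s₀, ∀ᵐ z ∂(volume.restrict T : Measure (ℝ × ℝ)),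
      z ∈ B.bad s → B.sup s * μ z ≤ (1 / 2) ^ s)
    {f : ℝ × ℝ → ℝ} (hf : AEMeasurable f (volume.restrict T)) {σ : ℕ → ℕ} (hσ : StrictMono σ)
    (hσ₀ : ∀ k, s₀ ≤ σ k)
    (hfσ : ∀ k, weightedNorm μ
      (fun z => f z - ∑ l ∈ Finset.range k, B.poly (σ l) z - B.step (σ k) z) ≤
        ENNReal.ofReal ((1 / 2) ^ k))
    {K : ℕ} {C : Finset (ℕ × ℕ)} (hC : IsLowerIndexSet C)
    (hK : block 1 (B.N (σ K + 1)) ⊆ C) :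
    weightedNorm μ (fun z => partialSum ((B.subseries σ).indicator B.coeff) C z - f z) ≤
      7 * ENNReal.ofReal ((1 / 2) ^ K) := by
  set R : ℕ → ℝ × ℝ → ℝ := fun k z => f z - ∑ l ∈ Finset.range k, B.poly (σ l) z with hR
  set δ : ℕ → ENNReal := fun k => ENNReal.ofReal ((1 / 2) ^ k) with hδ
  have hδmono : Antitone δ := fun k l h =>
    ENNReal.ofReal_le_ofReal (pow_le_pow_of_le_one (by norm_num) (by norm_num) h)
  have hRm : ∀ k, AEMeasurable (R k) (volume.restrict T) := fun k =>
    hf.sub (Finset.measurable_fun_sum _ fun l _ => B.measurable_poly _).aemeasurable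
  have hR1 : ∀ k, weightedNorm μ (R (k + 1)) ≤ 2 * δ k := by
    intro k
    have h1 : R (k + 1) = fun z => (R k z - B.step (σ k) z) +
        (B.step (σ k) z - B.poly (σ k) z) := by
      funext z
      simp only [hR, Finset.sum_range_succ]
      ring
    rw [h1, two_mul]
    refine (weightedNorm_add_le hμ
      ((B.measurable_step _).sub (B.measurable_poly _)).aemeasurable).trans
      (add_le_add (hfσ k) ?_)
    exact (weightedNorm_step_sub_poly_le hμ (hs _ (hσ₀ k))).trans (hδmono hσ.le_apply)
  obtain ⟨κ, hκ, hsum⟩ := exists_partialSum_subseries_eq (B := B) hσ hC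
  have hKκ : K < κ := by
    by_contra hc
    refine hκ (Finset.Subset.trans (fun i hi => ?_) hK)
    have h1 := mem_block.mp hi
    have h2 := B.strictMono.monotone
      (Nat.add_le_add_right (hσ.monotone (not_lt.mp hc)) 1)
    have h3 := B.one_le (σ κ)
    exact mem_block.mpr (by omega)
  obtain ⟨k, rfl⟩ : ∃ k, κ = k + 1 := ⟨κ - 1, by omega⟩
  have hstep : weightedNorm μ (B.step (σ (k + 1))) ≤
      weightedNorm μ (R (k + 1)) + δ (k + 1) := by
    have h1 : weightedNorm μ (B.step (σ (k + 1))) ≤ weightedNorm μ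
        (fun z => R (k + 1) z - B.step (σ (k + 1)) z) + weightedNorm μ (R (k + 1)) := by
      have h2 : B.step (σ (k + 1)) = fun z =>
          -(R (k + 1) z - B.step (σ (k + 1)) z) + R (k + 1) z := by
        funext z
        ring
      calc weightedNorm μ (B.step (σ (k + 1)))
          = weightedNorm μ (fun z => -(R (k + 1) z - B.step (σ (k + 1)) z) + R (k + 1) z) := by
            rw [← h2]
        _ ≤ _ := (weightedNorm_add_le hμ (hRm _)).trans_eq (by rw [weightedNorm_neg])
    exact h1.trans (by rw [add_comm]; exact add_le_add le_rfl (hfσ (k + 1)))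
  have herr : (fun z => partialSum ((B.subseries σ).indicator B.coeff) C z - f z) =
      fun z => -R (k + 1) z + partialSum (B.d (σ (k + 1))) C z := by
    funext z
    rw [hsum]
    simp only [hR]
    ring
  have hkK : δ k ≤ δ K := hδmono (by omega)
  rw [herr]
  calc _ ≤ weightedNorm μ (R (k + 1)) + weightedNorm μ (partialSum (B.d (σ (k + 1))) C) :=
        (weightedNorm_add_le hμ (measurable_partialSum _ _).aemeasurable).trans_eq
          (by rw [weightedNorm_neg])
    _ ≤ weightedNorm μ (R (k + 1)) +
          (weightedNorm μ (R (k + 1)) + δ (k + 1) + 2 * δ (σ (k + 1))) := by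
        gcongr
        exact (weightedNorm_truncation_le hμ (hs _ (hσ₀ _)) hC).trans
          (add_le_add hstep le_rfl)
    _ ≤ 2 * δ k + (2 * δ k + δ k + 2 * δ k) := by
        have h1 := hR1 k
        have h2 : δ (k + 1) ≤ δ k := hδmono (Nat.le_succ k)
        have h3 : δ (σ (k + 1)) ≤ δ k := hδmono ((Nat.le_succ k).trans hσ.le_apply)
        gcongr
    _ = 7 * δ k := by ring
    _ ≤ 7 * δ K := by gcongr

end BlockSystem

lemma rectSum_eq_partialSum (c : ℕ × ℕ → ℝ) (n m : ℕ) (z : ℝ × ℝ) :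
    rectSum c n m z = partialSum c (Finset.Icc 1 n ×ˢ Finset.Icc 1 m) z := by
  rw [rectSum, partialSum, Finset.sum_product]

lemma isLowerIndexSet_rect (n m : ℕ) :
    IsLowerIndexSet (Finset.Icc 1 n ×ˢ Finset.Icc 1 m) := by
  intro i hi j h1 h2 h3 h4
  simp only [Finset.mem_product, Finset.mem_Icc] at hi ⊢
  omega

lemma isLowerIndexSet_spher (R : ℝ) :
    IsLowerIndexSet ((Finset.Icc 1 ⌊R⌋₊ ×ˢ Finset.Icc 1 ⌊R⌋₊).filter
      fun i => (i.1 : ℝ) ^ 2 + (i.2 : ℝ) ^ 2 ≤ R ^ 2) := by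
  intro i hi j h1 h2 h3 h4
  simp only [Finset.mem_filter, Finset.mem_product, Finset.mem_Icc] at hi ⊢
  refine ⟨by omega, le_trans ?_ hi.2⟩
  gcongr

lemma block_subset_spher {L : ℕ} {R : ℝ} (h : 2 * (L : ℝ) ≤ R) :
    block 1 L ⊆ (Finset.Icc 1 ⌊R⌋₊ ×ˢ Finset.Icc 1 ⌊R⌋₊).filter
      fun i => (i.1 : ℝ) ^ 2 + (i.2 : ℝ) ^ 2 ≤ R ^ 2 := by
  intro i hi
  have hi := mem_block.mp hi
  have hL : 2 * L ≤ ⌊R⌋₊ := Nat.le_floor (by exact_mod_cast h)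
  simp only [Finset.mem_filter, Finset.mem_product, Finset.mem_Icc]
  refine ⟨by omega, ?_⟩
  have h1 : (i.1 : ℝ) ≤ L := by exact_mod_cast hi.1.2.le
  have h2 : (i.2 : ℝ) ≤ L := by exact_mod_cast hi.2.2.le
  have h3 : (0 : ℝ) ≤ i.1 := Nat.cast_nonneg _
  have h4 : (0 : ℝ) ≤ i.2 := Nat.cast_nonneg _
  nlinarith

theorem universalSubseries_coeff {B : BlockSystem} {μ : ℝ × ℝ → ℝ} (hμ : IsWeight μ)
    (hdense : ∀ f, MemL1 μ f → ∀ (δ : ℝ) (n : ℕ), 0 < δ →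
      ∃ s ≥ n, weightedNorm μ (fun z => f z - B.step s z) ≤ ENNReal.ofReal δ) {s₀ : ℕ}
    (hs : ∀ s ≥ s₀, ∀ᵐ z ∂(volume.restrict T : Measure (ℝ × ℝ)),
      z ∈ B.bad s → B.sup s * μ z ≤ (1 / 2) ^ s) : UniversalSubseries B.coeff μ := by
  intro f hf
  obtain ⟨σ, hσ, hσ₀, hfσ⟩ := BlockSystem.exists_greedy hμ hdense hf s₀
  have hδ : Tendsto (fun K : ℕ => 7 * ENNReal.ofReal ((1 / 2) ^ K)) atTop (𝓝 0) := by
    have := ENNReal.tendsto_ofReal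
      (tendsto_pow_atTop_nhds_zero_of_lt_one (r := (1 / 2 : ℝ)) (by norm_num) (by norm_num))
    rw [ENNReal.ofReal_zero] at this
    simpa using ENNReal.Tendsto.const_mul (a := 7) this (Or.inr (by norm_num))
  refine ⟨B.subseries σ, B.subseries_infinite hσ, ?_, ?_, ?_⟩
  · rintro i ⟨k, hk⟩
    have h1 := mem_block.mp hk
    have h2 := B.one_le (σ k)
    omega
  · rw [ENNReal.tendsto_nhds_zero]
    intro ε hε
    obtain ⟨K, hK⟩ := (hδ.eventually_le_const hε).exists
    filter_upwards [eventually_ge_atTop (B.N (σ K + 1), B.N (σ K + 1))] with N hN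
    simp only [rectSum_eq_partialSum]
    refine (BlockSystem.weightedNorm_partialSum_sub_le hμ hs hf.1 hσ hσ₀ hfσ
      (isLowerIndexSet_rect N.1 N.2) fun i hi => ?_).trans hK
    have h1 := mem_block.mp hi
    have h2 : B.N (σ K + 1) ≤ N.1 := hN.1
    have h3 : B.N (σ K + 1) ≤ N.2 := hN.2
    simp only [Finset.mem_product, Finset.mem_Icc]
    omega
  · rw [ENNReal.tendsto_nhds_zero]
    intro ε hε
    obtain ⟨K, hK⟩ := (hδ.eventually_le_const hε).exists
    filter_upwards [eventually_ge_atTop (2 * (B.N (σ K + 1) : ℝ))] with R hR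
    exact (BlockSystem.weightedNorm_partialSum_sub_le hμ hs hf.1 hσ hσ₀ hfσ
      (isLowerIndexSet_spher R) (block_subset_spher hR)).trans hK

end DoubleWalsh

theorem theorem3 :
    ∃ c : ℕ × ℕ → ℝ,
      (∀ q : ℝ, 2 < q → Summable (fun i : ℕ × ℕ => |c (i.1 + 1, i.2 + 1)| ^ q)) ∧
      ∀ ε : ℝ, 0 < ε →
        ∃ μ : ℝ × ℝ → ℝ, Measurable μ ∧
          (∀ p ∈ DoubleWalsh.T, 0 < μ p ∧ μ p ≤ 1) ∧
          volume {p ∈ DoubleWalsh.T | μ p ≠ 1} < ENNReal.ofReal ε ∧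
          DoubleWalsh.UniversalSubseries c μ := by
  obtain ⟨B, hB⟩ := DoubleWalsh.exists_blockSystem
  refine ⟨B.coeff, fun q hq => ?_, fun ε hε => ?_⟩
  · refine (B.summable_coeff_rpow hq).comp_injective
      (i := fun i : ℕ × ℕ => (i.1 + 1, i.2 + 1)) fun i j h => ?_
    simpa [Prod.ext_iff] using h
  · obtain ⟨μ, s₀, hμ, hvol, hs⟩ := B.exists_weight hε
    exact ⟨μ, hμ.measurable, fun z _ => ⟨hμ.pos z, hμ.le_one z⟩, hvol,
      DoubleWalsh.universalSubseries_coeff hμ (fun f hf => hB μ f hμ hf) hs⟩
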